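/- **Triangulation and fundamental family.** Let $\pi=\langle x_1,x_2,x_3\mid x_1x_2=x_2x_3=x_3x_1\rangle$ be the Wirtinger group of the standard three-crossing diagram of the left-handed trefoil $3_1$ (indices modulo $3$), where $x_i$ belongs to the overpass through the $i$th crossing. Consider the pseudotriangulation of $S^3$ with vertices $A_i$ (over) and $B_i$ (under) at the crossings, $i=1,2,3$, and $O$ below and $P$ above the diagram, which has 32 edges and 24 tetrahedra. Let $g\tilde v$, $g\in\pi$, be the lifts of a vertex $v$ to the branched covering on which $\pi$ acts; $\tilde A_i$ is fixed by $x_i$ and $\tilde B_i$ by $x_{i+1}$. Tildes are omitted below. Choose the family $\mathcal F$ of one lift of each simplex as follows. * Edges on the link: $B_{i-1}A_i$ and $A_{i-1}(x_iB_i)$. * Other edges: $A_iB_i$, $A_iO$, $A_i(x_{i+1}O)$, $A_iP$, $B_iO$, $B_iP$, $(x_iB_i)P$ for $i=1,2,3$, and the five edges $(gO)P$ with $g=1,\,x_1,\,x_2,\,x_3,\,x_1x_2$, one for each region of the diagram. * Tetrahedra $UV(gO)P$, where $UV$ runs over $B_{i-1}A_i,\ A_iB_i$ for $g=1$; $A_iB_{i-1},\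 (x_iB_i)A_i,\ A_{i-1}(x_iB_i),\ B_{i-1}A_{i-1}$ for $g=x_i$; $(x_iB_i)A_{i-1},\ A_i(x_iB_i)$ for $g=x_1x_2$ (in each case $i=1,2,3$), with vertices ordered consistently with an orientation. **Geometry.** Let $\varphi_1\in\mathbb R$ and let $\rho:\pi\to SO(3)$ send each $x_i$ to the rotation through $\varphi_1$ about the $z$ axis. Assume $\cos\varphi_1\neq1$ ($\rho$ is nontrivial), $\cos\varphi_1\ne0$ and $\cos2\varphi_1\neq0$ (all tetrahedra below are nondegenerate). Put $\Gamma(A_i)=(0,0,i+2)$, $\Gamma(B_i)=(0,0,i-1)$, $\Gamma(O)=(1,0,0)$, $\Gamma(P)=(0,1,0)$ and $\Gamma(gv)=\rho(g)\Gamma(v)$. For an edge $e$ of $\mathcal F$ let $l_e$ be its Euclidean length in $\mathbb R^3$ and $L_e=\frac12l_e^2$. For a tetrahedron let $V$ be its signed volume. Let $\omega_e$ be the total angle around $e$ minus the sum of the dihedral angles at $e$ of the tetrahedra of $\mathcal F$ (modulo $2\pi$, taken in $(-\pi,\pi]$), each dihedral angle being a function of the lengths taken with the sign of $V$ at $\Gamma$.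 The total angle is $2\pi$ for an edge off the link. For an edge on the link it is the angle $\pm\varphi_1$ of the rotation representing its meridian, taken about the image of the edge directed along the link, so that the sign is $+$ if this image points upwards and $-$ otherwise. Put $\Omega_e=\omega_e/l_e$. Let $\mathfrak e(3)_\rho$ be the Lie algebra of infinitesimal motions of $\mathbb R^3$ fixed by $\mathrm{Ad}_{\rho(h)}$ for all $h\in\pi$. Let $(dx)$ be the $12$-dimensional space with coordinates, in this order, $dz_{A_1},dz_{A_2},dz_{A_3},dz_{B_1},dz_{B_2},dz_{B_3},dx_O,dy_O,dz_O,dx_P,dy_P,dz_P$. Let $f_1$ be the matrix of the map from $\mathfrak e(3)_\rho$ to $(dx)$ that takes an infinitesimal motion to the velocities of the vertices, $f_2=(\partial L_e/\partial x_k)$ ($32\times12$) and $f_3=(\partial\Omega_e/\partial L_{e'})$ ($32\times 32$), all evaluated at $\Gamma$. Let $$\mathcal B_1=\{dz_{A_1},dy_O\},$$ let $\mathcal B_2$ consist of the ten edges $$B_3A_1,\ A_1(x_2B_2),\ B_2A_3,\ A_3(x_1B_1),\ B_1A_2,\ A_1(x_2O),\ A_1P,\ B_1O,\ (x_1B_1)P,\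 OP$$ (the last one with $g=1$), and let $\mathcal B_3$ be the set of the other $22$ edges. Denote by $\det{}_{\mathcal B_1}f_1$ the minor of $f_1$ with rows $\mathcal B_1$, by $\det{}_{\mathcal B_2}f_2$ the minor of $f_2$ with rows $\mathcal B_2$ and columns outside $\mathcal B_1$ (in the orders listed), by $\det{}_{\mathcal B_3}f_3$ the principal minor of $f_3$ on $\mathcal B_3$. Put $$\tau=\frac{(\det{}_{\mathcal B_2}f_2)^2(-1)^{\operatorname{rank}f_2}}{\det{}_{\mathcal B_3}f_3\,(\det{}_{\mathcal B_1}f_1)^2},\qquad I_\rho(3_1)=\tau\cdot\frac{(2-2\cos\varphi_1)^{6}}{\prod' l_e^2\cdot\prod(-6V)},$$ where $\prod'$ runs over the six edges of $\mathcal F$ on the link, $\prod$ over the 24 tetrahedra, and the exponent $6$ is the number of vertices on the link. **Statement.** The infinitesimal rotation $d\varphi_z$ about the $z$ axis and the infinitesimal translation $dz$ along it form a basis of $\mathfrak e(3)_\rho$. With respect to this basis, in the order $(d\varphi_z,dz)$, $$\det{}_{\mathcal B_1}f_1=-1,\qquad \det{}_{\mathcal B_2}f_2=1440,\qquad \det{}_{\mathcal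 B_3}f_3=-\frac{(1-\cos\varphi_1)^4(1-2\cos\varphi_1)^4}{167961600\,\cos^{12}\varphi_1\,(2\cos^2\varphi_1-1)^6}.$$ If moreover $1-2\cos\varphi_1\neq0$, then $$I_\rho(3_1)=-\frac{(2-2\cos\varphi_1)^2}{(1-2\cos\varphi_1)^4}=-\left|\frac{e^{i\varphi_1}-1}{\Delta(e^{i\varphi_1})}\right|^4,\qquad \Delta(t)=t^2-t+1 .$$ -/

import Mathlib

noncomputable section

/-- Euclidean 3-space. -/
abbrev Pt : Type := EuclideanSpace ℝ (Fin 3)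

/-- The group of motions of Euclidean 3-space. -/
abbrev Motion : Type := Pt ≃ᵃⁱ[ℝ] Pt

/-! ## Infinitesimal motions and the Lie algebra of the centralizer -/

/-- `e(3)`: infinitesimal motions, as vector fields `x ↦ S x + t` with `S` skew-symmetric. -/
def infMotions : Submodule ℝ (Pt → Pt) where
  carrier := {u | ∃ (S : Pt →ₗ[ℝ] Pt) (t : Pt),
    (∀ x, inner ℝ (S x) x = 0) ∧ ∀ x, u x = S x + t}
  add_mem' := by
    rintro u v ⟨S, t, hS, hu⟩ ⟨S', t', hS', hv⟩
    refine ⟨S + S', t + t', fun x => ?_, fun x => ?_⟩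
    · simp [inner_add_left, hS, hS']
    · simp only [Pi.add_apply, LinearMap.add_apply, hu, hv]; abel
  zero_mem' := ⟨0, 0, by simp, by simp⟩
  smul_mem' := by
    rintro c u ⟨S, t, hS, hu⟩
    refine ⟨c • S, c • t, fun x => ?_, fun x => ?_⟩
    · simp [inner_smul_left, hS]
    · simp [hu]

/-- The adjoint action of a motion on vector fields: push-forward. -/
def adMotion (g : Motion) (u : Pt → Pt) : Pt → Pt :=
  fun x => g.linearIsometryEquiv (u (g⁻¹ x))

/-- `e(3)_ρ`: infinitesimal motions fixed by `Ad_{ρ(h)}` for all `h`. -/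
def centralizerAlgebra {G : Type} [Group G] (ρ : G →* Motion) : Submodule ℝ (Pt → Pt) where
  carrier := {u | u ∈ infMotions ∧ ∀ h, adMotion (ρ h) u = u}
  add_mem' := by
    rintro u v ⟨hu, hu'⟩ ⟨hv, hv'⟩
    refine ⟨infMotions.add_mem hu hv, fun h => ?_⟩
    conv_rhs => rw [← hu' h, ← hv' h]
    funext x
    simp [adMotion]
  zero_mem' := ⟨infMotions.zero_mem, fun h => by funext x; simp [adMotion]⟩
  smul_mem' := by
    rintro c u ⟨hu, hu'⟩
    refine ⟨infMotions.smul_mem c hu, fun h => ?_⟩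
    conv_rhs => rw [← hu' h]
    funext x
    simp [adMotion]

/-! ## Pseudotriangulations with a fundamental family

A vertex of the branched covering space over a vertex `v` of the base is written as a pair `(g, v)`
with `g` in the link group `G`; it stands for `g · ṽ`, where `ṽ` is the vertex of the fundamental
family over `v`.  If `v` lies on the link, then `ṽ` is fixed by a meridian, and `(g, v)`, `(g', v)`
stand for the same vertex when `g` and `g'` differ by a power of this meridian. -/

/-- `(g, v)` and `(g', v')` are the same vertex of the covering space.
Vertices `Sum.inl v` lie on the link, vertices `Sum.inr w` do not. -/
def SameVertex {G VL VO : Type} [Group G] (meridian : VL → G) (a b : G × (VL ⊕ VO)) : Prop :=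
  a.2 = b.2 ∧ match a.2 with
    | Sum.inl v => a.1⁻¹ * b.1 ∈ Subgroup.zpowers (meridian v)
    | Sum.inr _ => a.1 = b.1

/-- The two ends of an edge, from those of the link edges and of the other edges. -/
def edgeEnds {G VL VO EL EO : Type} (linkEnds : EL → (G × VL) × (G × VL))
    (offEnds : EO → (G × (VL ⊕ VO)) × (G × (VL ⊕ VO))) :
    EL ⊕ EO → (G × (VL ⊕ VO)) × (G × (VL ⊕ VO))
  | Sum.inl e => (((linkEnds e).1.1, Sum.inl (linkEnds e).1.2),
      ((linkEnds e).2.1, Sum.inl (linkEnds e).2.2))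
  | Sum.inr e => offEnds e

/-- A pseudotriangulation whose link runs along edges, with a fundamental family of simplices in the
covering space.  `G` is the link group, `J` the set of link components, `VL` / `VO` the vertices
on / off the link, `EL` / `EO` the edges on / off the link, `T` the tetrahedra. -/
structure FundamentalFamily (G J VL VO EL EO T : Type) [Group G] where
  /-- The meridian fixing the vertex of the family over a link vertex. -/
  meridian : VL → G
  /-- The link component of a link vertex. -/
  compV : VL → J
  /-- The link component of a link edge. -/
  compE : EL → J
  /-- First and last vertex of a link edge of the family, along the orientation of the link. -/
  linkEnds : EL → (G × VL) × (G × VL)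
  /-- The ends of the other edges of the family. -/
  offEnds : EO → (G × (VL ⊕ VO)) × (G × (VL ⊕ VO))
  /-- The tetrahedra of the family, their vertices ordered according to a consistent orientation of
  the covering space. -/
  tet : T → Fin 4 → G × (VL ⊕ VO)
  /-- The edge of the pseudotriangulation joining two different vertices of a tetrahedron
  (a value for equal indices has no meaning and is never used). -/
  tetEdge : T → Fin 4 → Fin 4 → EL ⊕ EO
  /-- Both ends of a link edge have the same meridian. -/
  meridian_eq : ∀ e, (linkEnds e).1.1 * meridian (linkEnds e).1.2 * (linkEnds e).1.1⁻¹
    = (linkEnds e).2.1 * meridian (linkEnds e).2.2 * (linkEnds e).2.1⁻¹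
  /-- The order of the two vertices does not matter. -/
  tetEdge_symm : ∀ t i j, tetEdge t i j = tetEdge t j i
  /-- Each edge of a tetrahedron is a translate of the edge of the family with that name. -/
  tetEdge_spec : ∀ t i j, i < j → ∃ g : G,
    let ends := edgeEnds linkEnds offEnds (tetEdge t i j)
    (SameVertex meridian (tet t i) (g * ends.1.1, ends.1.2) ∧
        SameVertex meridian (tet t j) (g * ends.2.1, ends.2.2)) ∨
      (SameVertex meridian (tet t j) (g * ends.1.1, ends.1.2) ∧
        SameVertex meridian (tet t i) (g * ends.2.1, ends.2.2))

/-- Index set of the distinguished basis of `(dx)`: one coordinate (along the axis) for a vertex on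
the link, three Cartesian coordinates for any other vertex. -/
abbrev Coord (VL VO : Type) : Type := VL ⊕ (VO × Fin 3)

/-- Geometric data: the images of the vertices of the fundamental family, the unit directing vectors
of the axes on which the link vertices lie, and the rotation angles of the link components. -/
structure Placement (J VL VO : Type) where
  pos : VL ⊕ VO → Pt
  axis : VL → Pt
  angle : J → ℝ

/-- Displace the vertices of the family, those on the link along their axes. -/
def Placement.move {J VL VO : Type} (p : Placement J VL VO) (ξ : Coord VL VO → ℝ) :
    Placement J VL VO where
  pos
    | Sum.inl v => p.pos (Sum.inl v) + ξ (Sum.inl v) • p.axis v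
    | Sum.inr w => p.pos (Sum.inr w) + WithLp.toLp 2 (fun k => ξ (Sum.inr (w, k)))
  axis := p.axis
  angle := p.angle

/-- `f₁` : the velocities of the vertices under the infinitesimal motions `b a`, in the
distinguished coordinates of `(dx)`. -/
def matF1 {J VL VO ι : Type} (p : Placement J VL VO) (b : ι → Pt → Pt) :
    Matrix (Coord VL VO) ι ℝ :=
  Matrix.of fun k a => match k with
    | Sum.inl v => inner ℝ (p.axis v) (b a (p.pos (Sum.inl v)))
    | Sum.inr (w, k) => b a (p.pos (Sum.inr w)) k

/-- For each ordered pair of vertices spanning an edge, listed once per edge of a tetrahedron, the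
pair followed by the two remaining vertices. -/
def tetPairs : Fin 6 → Fin 4 × Fin 4 × Fin 4 × Fin 4 :=
  ![(0, 1, 2, 3), (0, 2, 1, 3), (0, 3, 1, 2), (1, 2, 0, 3), (1, 3, 0, 2), (2, 3, 0, 1)]

/-- The interior dihedral angle at the edge `ij` of a Euclidean tetrahedron with vertices
`i, j, k, l`, from the halved squared lengths `M` of its edges.  With `u, v, w` the vectors from `i`
to `j, k, l` one has `⟪v, w⟫ = M i k + M i l - M k l`, and so on; the angle is the one between the
components of `v` and `w` orthogonal to `u`. -/
def dihedral (M : Fin 4 → Fin 4 → ℝ) (q : Fin 4 × Fin 4 × Fin 4 × Fin 4) : ℝ :=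
  let i := q.1
  let j := q.2.1
  let k := q.2.2.1
  let l := q.2.2.2
  let uu := 2 * M i j
  let vv := 2 * M i k
  let ww := 2 * M i l
  let uv := M i j + M i k - M j k
  let uw := M i j + M i l - M j l
  let vw := M i k + M i l - M k l
  Real.arccos ((uu * vw - uv * uw) / Real.sqrt ((uu * vv - uv ^ 2) * (uu * ww - uw ^ 2)))

namespace FundamentalFamily

variable {G J VL VO EL EO T : Type} [Group G]

/-- The image under `Γ` of a vertex of the covering space: `Γ(g ṽ) = ρ(g) Γ(ṽ)`. -/
def image (ρ : G →* Motion) (p : Placement J VL VO) (a : G × (VL ⊕ VO)) : Pt :=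
  ρ a.1 (p.pos a.2)

/-- The two ends of an edge of the family. -/
def ends (F : FundamentalFamily G J VL VO EL EO T) :
    EL ⊕ EO → (G × (VL ⊕ VO)) × (G × (VL ⊕ VO)) :=
  edgeEnds F.linkEnds F.offEnds

/-- The Euclidean length `l_e` of the image of an edge. -/
def edgeLength (F : FundamentalFamily G J VL VO EL EO T) (ρ : G →* Motion) (p : Placement J VL VO)
    (e : EL ⊕ EO) : ℝ :=
  dist (image ρ p (F.ends e).1) (image ρ p (F.ends e).2)

/-- `L_e = l_e² / 2`. -/
def edgeL (F : FundamentalFamily G J VL VO EL EO T) (ρ : G →* Motion) (p : Placement J VL VO)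
    (e : EL ⊕ EO) : ℝ :=
  F.edgeLength ρ p e ^ 2 / 2

/-- The signed volume of the image of a tetrahedron: positive when `Γ` preserves its orientation. -/
def signedVol (F : FundamentalFamily G J VL VO EL EO T) (ρ : G →* Motion) (p : Placement J VL VO)
    (t : T) : ℝ :=
  (Matrix.of fun r c : Fin 3 =>
    (image ρ p (F.tet t r.succ) - image ρ p (F.tet t 0)) c).det / 6

open Classical in
/-- The sum of the signed dihedral angles at the edge `e`, taken over the tetrahedra of the family,
as a function of the variables `L_j`.  The sign is that of the volume at the given placement. -/
def angleSum [Fintype T] (F : FundamentalFamily G J VL VO EL EO T) (ρ : G →* Motion)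
    (p : Placement J VL VO) (L : EL ⊕ EO → ℝ) (e : EL ⊕ EO) : ℝ :=
  ∑ t : T, ∑ q : Fin 6,
    if F.tetEdge t (tetPairs q).1 (tetPairs q).2.1 = e then
      Real.sign (F.signedVol ρ p t) * dihedral (fun i j => L (F.tetEdge t i j)) (tetPairs q)
    else 0

/-- The total angle around an edge in a flat configuration.  Off the link it is `2π`.  The
tetrahedra of the family at a link edge span the angle of the rotation that represents the meridian
of the edge; this rotation is taken about the image of the edge, directed along the link, so that
its angle is `φ_j` or `-φ_j` according as this direction agrees or not with the directing
vector of the axis. -/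
def totalAngle (F : FundamentalFamily G J VL VO EL EO T) (ρ : G →* Motion)
    (p : Placement J VL VO) : EL ⊕ EO → ℝ
  | Sum.inl e =>
      Real.sign (inner ℝ ((ρ (F.linkEnds e).1.1).linearIsometryEquiv (p.axis (F.linkEnds e).1.2))
        (image ρ p (F.ends (Sum.inl e)).2 - image ρ p (F.ends (Sum.inl e)).1)) *
      p.angle (F.compE e)
  | Sum.inr _ => 2 * Real.pi

/-- The defect angle `ω_e`, an angle modulo `2π`, represented in `(-π, π]`. -/
def defect [Fintype T] (F : FundamentalFamily G J VL VO EL EO T) (ρ : G →* Motion)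
    (p : Placement J VL VO) (L : EL ⊕ EO → ℝ) (e : EL ⊕ EO) : ℝ :=
  Real.Angle.toReal ((F.totalAngle ρ p e - F.angleSum ρ p L e : ℝ) : Real.Angle)

/-- `Ω_e = ω_e / l_e`, as a function of the variables `L_j = l_j² / 2`. -/
def scaledDefect [Fintype T] (F : FundamentalFamily G J VL VO EL EO T) (ρ : G →* Motion)
    (p : Placement J VL VO) (L : EL ⊕ EO → ℝ) (e : EL ⊕ EO) : ℝ :=
  F.defect ρ p L e / Real.sqrt (2 * L e)

open Classical in
/-- `f₂ = (∂L_e / ∂x_k)`. -/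
def matF2 (F : FundamentalFamily G J VL VO EL EO T) (ρ : G →* Motion) (p : Placement J VL VO) :
    Matrix (EL ⊕ EO) (Coord VL VO) ℝ :=
  Matrix.of fun e k => deriv (fun s : ℝ => F.edgeL ρ (p.move (Pi.single k s)) e) 0

open Classical in
/-- `f₃ = (∂Ω_i / ∂L_j)`, at the values `L_j` of the given placement. -/
def matF3 [Fintype T] (F : FundamentalFamily G J VL VO EL EO T) (ρ : G →* Motion)
    (p : Placement J VL VO) : Matrix (EL ⊕ EO) (EL ⊕ EO) ℝ :=
  Matrix.of fun i j =>
    deriv (fun s : ℝ => F.scaledDefect ρ p (Function.update (F.edgeL ρ p) j s) i) (F.edgeL ρ p j)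

end FundamentalFamily

/-! ## Minors, torsion and the invariant -/

/-- A choice of the subsets `𝓑₁` (enumerated by `b1`, complement enumerated by `c1`) of the basis
of `(dx)` and `𝓑₂` (enumerated by `b2`) of the basis of `(dL)`. -/
structure MinorChoice (K E ι κ : Type) where
  b1 : ι → K
  c1 : κ → K
  b2 : κ → E
  b1_inj : Function.Injective b1
  c1_inj : Function.Injective c1
  b2_inj : Function.Injective b2
  compl : Set.range c1 = (Set.range b1)ᶜ

namespace MinorChoice

variable {K E ι κ : Type}

/-- `det _{𝓑₁} f₁`. -/
def minor1 [Fintype ι] [DecidableEq ι] (c : MinorChoice K E ι κ) (f1 : Matrix K ι ℝ) : ℝ :=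
  (f1.submatrix c.b1 id).det

/-- `det _{𝓑₂} f₂` : rows `𝓑₂`, columns outside `𝓑₁`. -/
def minor2 [Fintype κ] [DecidableEq κ] (c : MinorChoice K E ι κ) (f2 : Matrix E K ℝ) : ℝ :=
  (f2.submatrix c.b2 c.c1).det

open Classical in
/-- `det _{𝓑₃} f₃` : rows and columns in `𝓑₃`, the complement of `𝓑₂`. -/
def minor3 [Fintype E] (c : MinorChoice K E ι κ) (f3 : Matrix E E ℝ) : ℝ :=
  (f3.submatrix (fun e : {e : E // e ∉ Set.range c.b2} => e.1)
    (fun e : {e : E // e ∉ Set.range c.b2} => e.1)).det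

/-- The torsion
`τ = (minor f₂)² (-1)^{rank f₂} / (minor f₃ (minor f₁)²)`. -/
def torsion [Fintype ι] [DecidableEq ι] [Fintype κ] [DecidableEq κ] [Fintype E] [Fintype K]
    (c : MinorChoice K E ι κ) (f1 : Matrix K ι ℝ) (f2 : Matrix E K ℝ) (f3 : Matrix E E ℝ) : ℝ :=
  (c.minor2 f2 ^ 2 * (-1) ^ f2.rank) / (c.minor3 f3 * c.minor1 f1 ^ 2)

end MinorChoice

open Classical in
/-- The invariant
`I_ρ = τ · ∏_j (2 - 2 cos φ_j)^{n_j} / (∏' l² · ∏ (-6V))`, where `b` is the distinguished basis of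
`e(3)_ρ` and `n_j` is the number of vertices of the family on the `j`th component. -/
def FundamentalFamily.invariant {G J VL VO EL EO T ι κ : Type} [Group G] [Fintype J] [Fintype VL]
    [Fintype VO] [Fintype EL] [Fintype EO] [Fintype T] [Fintype ι] [Fintype κ]
    (F : FundamentalFamily G J VL VO EL EO T) (ρ : G →* Motion) (p : Placement J VL VO)
    (b : ι → Pt → Pt) (c : MinorChoice (Coord VL VO) (EL ⊕ EO) ι κ) : ℝ :=
  c.torsion (matF1 p b) (F.matF2 ρ p) (F.matF3 ρ p) *
    ((∏ j : J, (2 - 2 * Real.cos (p.angle j)) ^ Fintype.card {v : VL // F.compV v = j}) /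
      ((∏ e : EL, F.edgeLength ρ p (Sum.inl e) ^ 2) * ∏ t : T, (-6 * F.signedVol ρ p t)))

/-! ## The left-handed trefoil

Indices `1, 2, 3` of the crossings are the elements `0, 1, 2` of `Fin 3`, cyclically ordered. -/

/-- Wirtinger relations of the left-handed trefoil: `x_i x_{i+1} = x_{i+1} x_{i+2}`, one for each
crossing. -/
def trefoilRels : Set (FreeGroup (Fin 3)) :=
  Set.range fun i : Fin 3 =>
    FreeGroup.of i * FreeGroup.of (i + 1) * (FreeGroup.of (i + 1) * FreeGroup.of (i + 2))⁻¹

/-- The trefoil group, with one generator for each overpass. -/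
abbrev TrefoilGroup : Type := PresentedGroup trefoilRels

/-- The Wirtinger generator `x_i` of the overpass through `A_i`. -/
def xgen (i : Fin 3) : TrefoilGroup := PresentedGroup.of i

theorem xgen_rel (i : Fin 3) : xgen i * xgen (i + 1) = xgen (i + 1) * xgen (i + 2) := by
  have h : PresentedGroup.mk trefoilRels
      (FreeGroup.of i * FreeGroup.of (i + 1) *
        (FreeGroup.of (i + 1) * FreeGroup.of (i + 2))⁻¹) = 1 :=
    PresentedGroup.one_of_mem ⟨i, rfl⟩
  rw [map_mul, map_inv, mul_inv_eq_one, map_mul, map_mul] at h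
  exact h

/-- The linear map underlying `rotZ`. -/
def rotZLin (φ : ℝ) : Pt →ₗ[ℝ] Pt where
  toFun x := !₂[Real.cos φ * x 0 - Real.sin φ * x 1, Real.sin φ * x 0 + Real.cos φ * x 1, x 2]
  map_add' x y := by
    ext i; fin_cases i <;> simp <;> ring
  map_smul' r x := by
    ext i; fin_cases i <;> simp <;> ring

theorem rotZLin_comp (φ : ℝ) : rotZLin φ ∘ₗ rotZLin (-φ) = LinearMap.id := by
  ext x i
  have := Real.sin_sq_add_cos_sq φ
  fin_cases i <;> simp [rotZLin] <;> grind

theorem rotZLin_norm (φ : ℝ) (x : Pt) : ‖rotZLin φ x‖ = ‖x‖ := by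
  have h := Real.sin_sq_add_cos_sq φ
  rw [EuclideanSpace.norm_eq, EuclideanSpace.norm_eq]
  congr 1
  simp only [rotZLin, Fin.sum_univ_three, Real.norm_eq_abs, sq_abs, LinearMap.coe_mk,
    AddHom.coe_mk, PiLp.toLp_apply, Matrix.cons_val_zero, Matrix.cons_val_one, Matrix.cons_val]
  linear_combination (x 0 ^ 2 + x 1 ^ 2) * h

/-- The rotation about the `z` axis through the angle `φ`. -/
def rotZ (φ : ℝ) : Motion :=
  LinearIsometryEquiv.toAffineIsometryEquiv
    { toLinearEquiv := LinearEquiv.ofLinearMap (rotZLin φ) (rotZLin (-φ)) (rotZLin_comp φ)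
        (by simpa using rotZLin_comp (-φ))
      norm_map' := rotZLin_norm φ }

theorem rotZ_apply (φ : ℝ) (x : Pt) : rotZ φ x =
    !₂[Real.cos φ * x 0 - Real.sin φ * x 1, Real.sin φ * x 0 + Real.cos φ * x 1, x 2] := rfl

/-- The abelian representation: every Wirtinger generator goes to `rotZ φ`. -/
def abelianRep (φ : ℝ) : TrefoilGroup →* Motion :=
  PresentedGroup.toGroup (f := fun _ : Fin 3 => rotZ φ) (by
    rintro r ⟨i, rfl⟩
    simp)

/-- Vertices on the link: over- and underpass points of the three crossings. -/
inductive TrefVL where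
  | A (i : Fin 3)
  | B (i : Fin 3)
  deriving DecidableEq, Fintype

/-- Vertices off the link: `O` below and `P` above the plane of the diagram. -/
inductive TrefVO where
  | O
  | P
  deriving DecidableEq

instance : Fintype TrefVO := ⟨{TrefVO.O, TrefVO.P}, fun x => by cases x <;> simp⟩

/-- Edges on the link: `toA i` from `B_{i-1}` to `A_i` and `toB i` from `A_{i-1}` to `B_i`. -/
inductive TrefEL where
  | toA (i : Fin 3)
  | toB (i : Fin 3)
  deriving DecidableEq, Fintype

/-- Edges off the link.  The five regions of the diagram are `low`, the three bigons (`mid i` lies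
between the crossings `i-1` and `i`) and `high`; the edges `OP` correspond to them. -/
inductive TrefEO where
  | AB (i : Fin 3)
  | AO (i : Fin 3)
  | AO' (i : Fin 3)
  | AP (i : Fin 3)
  | BO (i : Fin 3)
  | BP (i : Fin 3)
  | BP' (i : Fin 3)
  | OPlow
  | OPmid (i : Fin 3)
  | OPhigh
  deriving DecidableEq, Fintype

/-- Tetrahedra: for each region and each side of its boundary polygon the join of this side with
the edge `OP` of the region.  The sides are the link edges (`...A`, `...B` after the edges
`toA`, `toB`) and the edges `A_i B_i` (`...X`). -/
inductive TrefT where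
  | lowA (i : Fin 3)
  | lowX (i : Fin 3)
  | midA (i : Fin 3)
  | midX (i : Fin 3)
  | midB (i : Fin 3)
  | midX' (i : Fin 3)
  | highB (i : Fin 3)
  | highX (i : Fin 3)
  deriving DecidableEq, Fintype

namespace Trefoil

/-- The vertex `g A_i` of the covering space. -/
def vA (g : TrefoilGroup) (i : Fin 3) : TrefoilGroup × (TrefVL ⊕ TrefVO) := (g, Sum.inl (.A i))

/-- The vertex `g B_i`. -/
def vB (g : TrefoilGroup) (i : Fin 3) : TrefoilGroup × (TrefVL ⊕ TrefVO) := (g, Sum.inl (.B i))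

/-- The vertex `g O`. -/
def vO (g : TrefoilGroup) : TrefoilGroup × (TrefVL ⊕ TrefVO) := (g, Sum.inr .O)

/-- The vertex `g P`. -/
def vP (g : TrefoilGroup) : TrefoilGroup × (TrefVL ⊕ TrefVO) := (g, Sum.inr .P)

def linkEnds : TrefEL → (TrefoilGroup × TrefVL) × (TrefoilGroup × TrefVL)
  | .toA i => ((1, .B (i - 1)), (1, .A i))
  | .toB i => ((1, .A (i - 1)), (xgen i, .B i))

def offEnds : TrefEO →
    (TrefoilGroup × (TrefVL ⊕ TrefVO)) × (TrefoilGroup × (TrefVL ⊕ TrefVO))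
  | .AB i => (vA 1 i, vB 1 i)
  | .AO i => (vA 1 i, vO 1)
  | .AO' i => (vA 1 i, vO (xgen (i + 1)))
  | .AP i => (vA 1 i, vP 1)
  | .BO i => (vB 1 i, vO 1)
  | .BP i => (vB 1 i, vP 1)
  | .BP' i => (vB (xgen i) i, vP 1)
  | .OPlow => (vO 1, vP 1)
  | .OPmid i => (vO (xgen i), vP 1)
  | .OPhigh => (vO (xgen 0 * xgen 1), vP 1)

/-- The tetrahedra, all lifted so that they contain the same vertex `P`.  Crossing a strand of the
diagram multiplies the label of `O` by the Wirtinger generator of the strand. -/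
def tet : TrefT → Fin 4 → TrefoilGroup × (TrefVL ⊕ TrefVO)
  | .lowA i => ![vB 1 (i - 1), vA 1 i, vO 1, vP 1]
  | .lowX i => ![vA 1 i, vB 1 i, vO 1, vP 1]
  | .midA i => ![vA 1 i, vB 1 (i - 1), vO (xgen i), vP 1]
  | .midX i => ![vB (xgen i) i, vA 1 i, vO (xgen i), vP 1]
  | .midB i => ![vA 1 (i - 1), vB (xgen i) i, vO (xgen i), vP 1]
  | .midX' i => ![vB 1 (i - 1), vA 1 (i - 1), vO (xgen i), vP 1]
  | .highB i => ![vB (xgen i) i, vA 1 (i - 1), vO (xgen 0 * xgen 1), vP 1]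
  | .highX i => ![vA 1 i, vB (xgen i) i, vO (xgen 0 * xgen 1), vP 1]

/-- The table of edges of a tetrahedron from its edges `01, 02, 03, 12, 13, 23`. -/
def edgeTable {E : Type} (e01 e02 e03 e12 e13 e23 : E) : Fin 4 → Fin 4 → E :=
  ![![e01, e01, e02, e03], ![e01, e01, e12, e13], ![e02, e12, e01, e23], ![e03, e13, e23, e01]]

def tetEdge : TrefT → Fin 4 → Fin 4 → TrefEL ⊕ TrefEO
  | .lowA i => edgeTable (.inl (.toA i)) (.inr (.BO (i - 1))) (.inr (.BP (i - 1)))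
      (.inr (.AO i)) (.inr (.AP i)) (.inr .OPlow)
  | .lowX i => edgeTable (.inr (.AB i)) (.inr (.AO i)) (.inr (.AP i))
      (.inr (.BO i)) (.inr (.BP i)) (.inr .OPlow)
  | .midA i => edgeTable (.inl (.toA i)) (.inr (.AO i)) (.inr (.AP i))
      (.inr (.BO (i - 1))) (.inr (.BP (i - 1))) (.inr (.OPmid i))
  | .midX i => edgeTable (.inr (.AB i)) (.inr (.BO i)) (.inr (.BP' i))
      (.inr (.AO i)) (.inr (.AP i)) (.inr (.OPmid i))
  | .midB i => edgeTable (.inl (.toB i)) (.inr (.AO' (i - 1))) (.inr (.AP (i - 1)))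
      (.inr (.BO i)) (.inr (.BP' i)) (.inr (.OPmid i))
  | .midX' i => edgeTable (.inr (.AB (i - 1))) (.inr (.BO (i - 1))) (.inr (.BP (i - 1)))
      (.inr (.AO' (i - 1))) (.inr (.AP (i - 1))) (.inr (.OPmid i))
  | .highB i => edgeTable (.inl (.toB i)) (.inr (.BO i)) (.inr (.BP' i))
      (.inr (.AO' (i - 1))) (.inr (.AP (i - 1))) (.inr .OPhigh)
  | .highX i => edgeTable (.inr (.AB i)) (.inr (.AO' i)) (.inr (.AP i))
      (.inr (.BO i)) (.inr (.BP' i)) (.inr .OPhigh)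

/-- The meridians fixing `A_i` and `B_i`. -/
def meridian : TrefVL → TrefoilGroup
  | .A i => xgen i
  | .B i => xgen (i + 1)

theorem high_eq (i : Fin 3) : xgen 0 * xgen 1 = xgen i * xgen (i + 1) := by
  have h0 := xgen_rel 0
  have h1 := xgen_rel 1
  fin_cases i
  · rfl
  · exact h0
  · exact h0.trans h1

theorem high_eq' (i : Fin 3) : xgen 0 * xgen 1 = xgen (i - 1) * xgen i := by
  simpa using high_eq (i - 1)

theorem meridian_eq (e : TrefEL) :
    (linkEnds e).1.1 * meridian (linkEnds e).1.2 * (linkEnds e).1.1⁻¹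
      = (linkEnds e).2.1 * meridian (linkEnds e).2.2 * (linkEnds e).2.1⁻¹ := by
  rcases e with i | i
  · simp [linkEnds, meridian]
  · have h := (high_eq' i).symm.trans (high_eq i)
    simp [linkEnds, meridian, ← h]

theorem tetEdge_symm (t : TrefT) (i j : Fin 4) : tetEdge t i j = tetEdge t j i := by
  cases t <;> fin_cases i <;> fin_cases j <;> rfl

/-- The group element carrying an edge of the family to a given edge of a tetrahedron. -/
def shift : TrefT → Fin 4 → Fin 4 → TrefoilGroup
  | .lowA _ => edgeTable 1 1 1 1 1 1
  | .lowX _ => edgeTable 1 1 1 1 1 1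
  | .midA i => edgeTable 1 (xgen i) 1 (xgen i) 1 1
  | .midX i => edgeTable (xgen i) (xgen i) 1 (xgen i) 1 1
  | .midB i => edgeTable 1 1 1 (xgen i) 1 1
  | .midX' i => edgeTable 1 (xgen i) 1 1 1 1
  | .highB i => edgeTable 1 (xgen 0 * xgen 1) 1 (xgen (i - 1)) 1 1
  | .highX i => edgeTable (xgen i) (xgen i) 1 (xgen 0 * xgen 1) 1 1

theorem tetEdge_spec (t : TrefT) (i j : Fin 4) (hij : i < j) : ∃ g : TrefoilGroup,
    let ends := edgeEnds linkEnds offEnds (tetEdge t i j)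
    (SameVertex meridian (tet t i) (g * ends.1.1, ends.1.2) ∧
        SameVertex meridian (tet t j) (g * ends.2.1, ends.2.2)) ∨
      (SameVertex meridian (tet t j) (g * ends.1.1, ends.1.2) ∧
        SameVertex meridian (tet t i) (g * ends.2.1, ends.2.2)) := by
  refine ⟨shift t i j, ?_⟩
  rcases t with k | k | k | k | k | k | k | k <;> fin_cases i <;> fin_cases j <;>
    first
    | exact absurd hij (by decide)
    | (simp [SameVertex, tet, tetEdge, shift, edgeTable, edgeEnds, linkEnds, offEnds, vA, vB, vO,
        vP, meridian, high_eq k]; done)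
    | simp [SameVertex, tet, tetEdge, shift, edgeTable, edgeEnds, linkEnds, offEnds, vA, vB, vO,
        vP, meridian, high_eq' k]

/-- The pseudotriangulation of the 3-sphere with the left-handed trefoil on its edges, and the
fundamental family. -/
def family : FundamentalFamily TrefoilGroup Unit TrefVL TrefVO TrefEL TrefEO TrefT where
  meridian := meridian
  compV _ := ()
  compE _ := ()
  linkEnds := linkEnds
  offEnds := offEnds
  tet := tet
  tetEdge := tetEdge
  meridian_eq := meridian_eq
  tetEdge_symm := tetEdge_symm
  tetEdge_spec := tetEdge_spec

/-- `A_i` is placed at `(0, 0, i + 2)`, `B_i` at `(0, 0, i - 1)` for `i = 1, 2, 3` (here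
`i.val + 1`), `O` at `(1, 0, 0)` and `P` at `(0, 1, 0)`; the axis is the `z` axis. -/
def placement (φ : ℝ) : Placement Unit TrefVL TrefVO where
  pos
    | Sum.inl (.A i) => !₂[0, 0, (i.val : ℝ) + 3]
    | Sum.inl (.B i) => !₂[0, 0, (i.val : ℝ)]
    | Sum.inr .O => !₂[1, 0, 0]
    | Sum.inr .P => !₂[0, 1, 0]
  axis _ := !₂[0, 0, 1]
  angle _ := φ

/-- `𝓒₀ = {dφ_z, dz}`: the infinitesimal rotation about the `z` axis and the infinitesimal
translation along it. -/
def basisC0 : Fin 2 → Pt → Pt :=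
  ![fun x => !₂[-x 1, x 0, 0], fun _ => !₂[0, 0, 1]]

/-- `dz_{A_i}`. -/
abbrev dzA (i : Fin 3) : Coord TrefVL TrefVO := Sum.inl (.A i)

/-- `dz_{B_i}`. -/
abbrev dzB (i : Fin 3) : Coord TrefVL TrefVO := Sum.inl (.B i)

/-- `dx_O, dy_O, dz_O`. -/
abbrev dO (k : Fin 3) : Coord TrefVL TrefVO := Sum.inr (.O, k)

/-- `dx_P, dy_P, dz_P`. -/
abbrev dP (k : Fin 3) : Coord TrefVL TrefVO := Sum.inr (.P, k)

/-- `𝓑₁ = {dz_{A_1}, dy_O}` and `𝓑₂`, consisting of the edges `B_3 A_1`, `A_1 (x_2 B_2)`,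
`B_2 A_3`, `A_3 (x_1 B_1)`, `B_1 A_2`, the second edge `A_1 O`, `A_1 P`, `B_1 O`, `(x_1 B_1) P`
and `O P`. -/
def choice : MinorChoice (Coord TrefVL TrefVO) (TrefEL ⊕ TrefEO) (Fin 2) (Fin 10) where
  b1 := ![dzA 0, dO 1]
  c1 := ![dzA 1, dzA 2, dzB 0, dzB 1, dzB 2, dO 0, dO 2, dP 0, dP 1, dP 2]
  b2 := ![.inl (.toA 0), .inl (.toB 1), .inl (.toA 2), .inl (.toB 0), .inl (.toA 1),
    .inr (.AO' 0), .inr (.AP 0), .inr (.BO 0), .inr (.BP' 0), .inr .OPlow]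
  b1_inj := by decide
  c1_inj := by decide
  b2_inj := by decide
  compl := by
    ext k
    simp only [Set.mem_range, Set.mem_compl_iff]
    revert k
    decide

end Trefoil
end

/-! The proof rests on a special shape of the geometry. Since `abelianRep` sends every group element
to a rotation about the z axis, every lift of a link vertex has the same image. Hence each
tetrahedron has two vertices on the axis, at heights `a` and `b`, and two on the unit circle at
height 0. It is determined by `a`, `b` and the angle between the circle points, whose cosine and
signed sine are `σ` and `γ`.

Edges then fall into three kinds: axis edges, spokes (axis to circle) and chords (the edges `OP`).
At the flat configuration the defects vanish modulo 2π, so differentiating `Ω = ω / l` only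
differentiates the angle sums, and the length in their derivatives cancels `l`; all entries of f₃
are rational in lengths and volumes (`matF3_apply`, `matF3_eq`). Two tetrahedra of a region that
share a spoke share the whole face spanned by it and the chord, and the terms depending only on this
face cancel. At a chord such face terms telescope around the region. So chord rows see only axis
edges, and spoke rows do not see chords.

Consequently the minor of f₃ is a product of two 4×4 determinants (chords against axis edges,
transposes of each other) and a 14×14 spoke determinant (`det_of_zero_blocks`). The spoke block is a
quadratic form which is a sum of nine forms of rank two, one for each axis edge. Seven of them are
written in 14 independent linear forms with a triangular coefficient matrix; the other two are a
perturbation of rank four. The matrix determinant lemma reduces everything to a 4×4 matrix with the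
scalar factor `(1 - 2c) / (1 - c)`, where `c` is the cosine of the angle (`core_eq`, `det_spoke`).
Its fourth power produces the power of the Alexander polynomial, because `Δ(e^{iφ}) = (2c - 1)
e^{iφ}`.

The rest is lighter: f₁ is explicit, the chosen minor of f₂ is triangular after reordering, `f₂ f₁ =
0` fixes the rank of f₂, and commuting with one nontrivial rotation determines the centralizer
algebra. -/

noncomputable section

/-! ### Derivatives of dihedral angles and defects with respect to the edge lengths. -/

/-- The numerator of the cosine of a dihedral angle at the edge `ij`. -/
def dihedralNum (M : Fin 4 → Fin 4 → ℝ) (q : Fin 4 × Fin 4 × Fin 4 × Fin 4) : ℝ :=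
  2 * M q.1 q.2.1 * (M q.1 q.2.2.1 + M q.1 q.2.2.2 - M q.2.2.1 q.2.2.2) -
    (M q.1 q.2.1 + M q.1 q.2.2.1 - M q.2.1 q.2.2.1) *
      (M q.1 q.2.1 + M q.1 q.2.2.2 - M q.2.1 q.2.2.2)

/-- The derivative of `dihedralNum` along `m`. -/
def dihedralNumRate (M m : Fin 4 → Fin 4 → ℝ) (q : Fin 4 × Fin 4 × Fin 4 × Fin 4) : ℝ :=
  2 * m q.1 q.2.1 * (M q.1 q.2.2.1 + M q.1 q.2.2.2 - M q.2.2.1 q.2.2.2) +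
    2 * M q.1 q.2.1 * (m q.1 q.2.2.1 + m q.1 q.2.2.2 - m q.2.2.1 q.2.2.2) -
    ((m q.1 q.2.1 + m q.1 q.2.2.1 - m q.2.1 q.2.2.1) *
      (M q.1 q.2.1 + M q.1 q.2.2.2 - M q.2.1 q.2.2.2) +
    (M q.1 q.2.1 + M q.1 q.2.2.1 - M q.2.1 q.2.2.1) *
      (m q.1 q.2.1 + m q.1 q.2.2.2 - m q.2.1 q.2.2.2))

/-- Four times the squared area of the triangle `ijk`. -/
def faceGram (M : Fin 4 → Fin 4 → ℝ) (i j k : Fin 4) : ℝ :=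
  2 * M i j * (2 * M i k) - (M i j + M i k - M j k) ^ 2

/-- The derivative of `faceGram` along `m`. -/
def faceGramRate (M m : Fin 4 → Fin 4 → ℝ) (i j k : Fin 4) : ℝ :=
  2 * m i j * (2 * M i k) + 2 * M i j * (2 * m i k) -
    2 * (M i j + M i k - M j k) * (m i j + m i k - m j k)

/-- Up to a positive factor, minus the derivative of the cosine of a dihedral angle. -/
def dihedralRate (M m : Fin 4 → Fin 4 → ℝ) (q : Fin 4 × Fin 4 × Fin 4 × Fin 4) : ℝ :=
  -(dihedralNumRate M m q - dihedralNum M q / 2 *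
    (faceGramRate M m q.1 q.2.1 q.2.2.1 / faceGram M q.1 q.2.1 q.2.2.1 +
      faceGramRate M m q.1 q.2.1 q.2.2.2 / faceGram M q.1 q.2.1 q.2.2.2))

theorem dihedral_eq (M : Fin 4 → Fin 4 → ℝ) (q : Fin 4 × Fin 4 × Fin 4 × Fin 4) :
    dihedral M q = Real.arccos (dihedralNum M q /
      √(faceGram M q.1 q.2.1 q.2.2.1 * faceGram M q.1 q.2.1 q.2.2.2)) := rfl

/-- The chain rule, arranged so that the only root left is that of `D - N²`. For a dihedral angle
this difference is the squared edge length times `(6V)²`. -/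
theorem hasDerivAt_arccos_div_sqrt {N D : ℝ → ℝ} {N' D' x : ℝ} (hN : HasDerivAt N N' x)
    (hD : HasDerivAt D D' x) (hD0 : 0 < D x) (hlt : N x ^ 2 < D x) :
    HasDerivAt (fun s => Real.arccos (N s / √(D s)))
      (-(N' - N x / 2 * (D' / D x)) / √(D x - N x ^ 2)) x := by
  have hr : 0 < √(D x) := Real.sqrt_pos.2 hD0
  have hr2 : √(D x) ^ 2 = D x := Real.sq_sqrt hD0.le
  have h1 := hN.div (hD.sqrt hD0.ne') hr.ne'
  have hsq : (N x / √(D x)) ^ 2 < 1 := by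
    rw [div_pow, hr2, div_lt_one hD0]; exact hlt
  have habs := abs_lt.1 ((sq_lt_one_iff_abs_lt_one _).1 hsq)
  have h2 := (Real.hasDerivAt_arccos (ne_of_gt habs.1) (ne_of_lt habs.2)).comp x h1
  refine h2.congr_deriv ?_
  have h3 : √(1 - (N x / √(D x)) ^ 2) = √(D x - N x ^ 2) / √(D x) := by
    rw [← Real.sqrt_div' _ hD0.le, div_pow, hr2]
    congr 1
    field_simp
  have h4 : 0 < √(D x - N x ^ 2) := Real.sqrt_pos.2 (by linarith)
  rw [h3]
  generalize √(D x) = r at *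
  generalize √(D x - N x ^ 2) = w at *
  rw [← hr2]
  field_simp

theorem hasDerivAt_dihedral {M : ℝ → Fin 4 → Fin 4 → ℝ} {m : Fin 4 → Fin 4 → ℝ} {x : ℝ}
    (hM : ∀ i j, HasDerivAt (fun s => M s i j) (m i j) x)
    (q : Fin 4 × Fin 4 × Fin 4 × Fin 4)
    (h1 : 0 < faceGram (M x) q.1 q.2.1 q.2.2.1) (h2 : 0 < faceGram (M x) q.1 q.2.1 q.2.2.2)
    (hlt : dihedralNum (M x) q ^ 2 <
      faceGram (M x) q.1 q.2.1 q.2.2.1 * faceGram (M x) q.1 q.2.1 q.2.2.2) :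
    HasDerivAt (fun s => dihedral (M s) q)
      (dihedralRate (M x) m q /
        √(faceGram (M x) q.1 q.2.1 q.2.2.1 * faceGram (M x) q.1 q.2.1 q.2.2.2 -
          dihedralNum (M x) q ^ 2)) x := by
  have hg : ∀ i j k, HasDerivAt (fun s => faceGram (M s) i j k)
      (faceGramRate (M x) m i j k) x := by
    intro i j k
    have := (((hM i j).const_mul 2).mul ((hM i k).const_mul 2)).sub
      ((((hM i j).add (hM i k)).sub (hM j k)).pow 2)
    refine this.congr_deriv ?_
    simp [faceGramRate]
  have hn : HasDerivAt (fun s => dihedralNum (M s) q) (dihedralNumRate (M x) m q) x := by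
    have := (((hM q.1 q.2.1).const_mul 2).mul
      (((hM q.1 q.2.2.1).add (hM q.1 q.2.2.2)).sub (hM q.2.2.1 q.2.2.2))).sub
      ((((hM q.1 q.2.1).add (hM q.1 q.2.2.1)).sub (hM q.2.1 q.2.2.1)).mul
        (((hM q.1 q.2.1).add (hM q.1 q.2.2.2)).sub (hM q.2.1 q.2.2.2)))
    exact this
  have h := hasDerivAt_arccos_div_sqrt hn ((hg q.1 q.2.1 q.2.2.1).mul (hg q.1 q.2.1 q.2.2.2))
    (mul_pos h1 h2) hlt
  refine h.congr_deriv ?_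
  simp only [Pi.mul_apply, dihedralRate]
  congr 3
  field_simp

/-- The value `f x` is a multiple of 2π, and subtracting this constant does not change the angle.
Near `x` the difference stays inside `(-π, π)`, where reduction modulo 2π is the identity. -/
theorem hasDerivAt_toReal_of_coe_eq_zero {f : ℝ → ℝ} {f' x : ℝ} (hf : HasDerivAt f f' x)
    (h0 : (f x : Real.Angle) = 0) :
    HasDerivAt (fun s => ((f s : ℝ) : Real.Angle).toReal) f' x := by
  have h1 : HasDerivAt (fun s => f s - f x) f' x := hf.sub_const _
  refine h1.congr_of_eventuallyEq ?_
  have h2 : ∀ᶠ s in nhds x, |f s - f x| < Real.pi := by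
    have := h1.continuousAt.abs
    refine this.eventually_lt continuousAt_const ?_
    simp [Real.pi_pos]
  filter_upwards [h2] with s hs
  have h3 : ((f s : ℝ) : Real.Angle) = ((f s - f x : ℝ) : Real.Angle) := by
    rw [Real.Angle.coe_sub, h0, sub_zero]
  rw [h3]
  exact Real.Angle.toReal_coe_eq_self_iff.2 ⟨(abs_lt.1 hs).1, (abs_lt.1 hs).2.le⟩

namespace FundamentalFamily

variable {G J VL VO EL EO T : Type} [Group G]

/-- Euclidean nondegeneracy of a tetrahedron at the edge named by `q`. -/
def NondegAt (M : Fin 4 → Fin 4 → ℝ) (V : ℝ) (q : Fin 4 × Fin 4 × Fin 4 × Fin 4) : Prop :=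
  0 < faceGram M q.1 q.2.1 q.2.2.1 ∧ 0 < faceGram M q.1 q.2.1 q.2.2.2 ∧
    0 < M q.1 q.2.1 ∧ V ≠ 0 ∧
    faceGram M q.1 q.2.1 q.2.2.1 * faceGram M q.1 q.2.1 q.2.2.2 - dihedralNum M q ^ 2 =
      2 * M q.1 q.2.1 * (6 * V) ^ 2

/-- By the Gram identity the root is the edge length times `6|V|`, and the sign turns `1 / |V|` into
`1 / V`. One factor, the length itself, is kept in front so that it can cancel against the
denominator of `Ω`. -/
theorem hasDerivAt_sign_mul_dihedral {M : ℝ → Fin 4 → Fin 4 → ℝ} {m : Fin 4 → Fin 4 → ℝ}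
    {x V : ℝ} (hM : ∀ i j, HasDerivAt (fun s => M s i j) (m i j) x)
    (q : Fin 4 × Fin 4 × Fin 4 × Fin 4) (h : NondegAt (M x) V q) :
    HasDerivAt (fun s => Real.sign V * dihedral (M s) q)
      (√(2 * M x q.1 q.2.1) * (dihedralRate (M x) m q / (2 * M x q.1 q.2.1 * (6 * V)))) x := by
  obtain ⟨h1, h2, h3, hV, h4⟩ := h
  have hpos : 0 < 2 * M x q.1 q.2.1 * (6 * V) ^ 2 := by positivity
  refine ((hasDerivAt_dihedral hM q h1 h2 (by linarith)).const_mul _).congr_deriv ?_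
  rw [h4, Real.sqrt_mul (by positivity), Real.sqrt_sq_eq_abs]
  have hu : 0 < 2 * M x q.1 q.2.1 := by positivity
  have hr : 0 < √(2 * M x q.1 q.2.1) := Real.sqrt_pos.2 hu
  have hr2 : √(2 * M x q.1 q.2.1) ^ 2 = 2 * M x q.1 q.2.1 := Real.sq_sqrt hu.le
  generalize √(2 * M x q.1 q.2.1) = r at *
  rw [← hr2]
  rcases lt_or_gt_of_ne hV with h | h
  · rw [Real.sign_of_neg h, abs_of_neg (by linarith)]; field_simp
  · rw [Real.sign_of_pos h, abs_of_pos (by linarith)]; field_simp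

-- In the quotient rule for `ω / l` the term with the derivative of `l` carries the factor `ω`,
-- which is zero by flatness. In the other term the length produced by
-- `hasDerivAt_sign_mul_dihedral` cancels `l`.
open Classical in
theorem matF3_apply [Fintype T] (F : FundamentalFamily G J VL VO EL EO T) (ρ : G →* Motion)
    (p : Placement J VL VO) (e e' : EL ⊕ EO)
    (hnd : ∀ t q, F.tetEdge t (tetPairs q).1 (tetPairs q).2.1 = e →
      NondegAt (fun i j => F.edgeL ρ p (F.tetEdge t i j)) (F.signedVol ρ p t) (tetPairs q))
    (hL : 0 < F.edgeL ρ p e)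
    (hflat : (F.angleSum ρ p (F.edgeL ρ p) e : Real.Angle) = (F.totalAngle ρ p e : ℝ)) :
    F.matF3 ρ p e e' = -∑ t : T, ∑ q : Fin 6,
      if F.tetEdge t (tetPairs q).1 (tetPairs q).2.1 = e then
        dihedralRate (fun i j => F.edgeL ρ p (F.tetEdge t i j))
          (fun i j => if F.tetEdge t i j = e' then 1 else 0) (tetPairs q) /
          (2 * F.edgeL ρ p e * (6 * F.signedVol ρ p t))
      else 0 := by
  set L := F.edgeL ρ p with hLdef
  have hup : ∀ j, HasDerivAt (fun s : ℝ => Function.update L e' s j)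
      (if j = e' then 1 else 0) (L e') := by
    intro j
    by_cases hj : j = e'
    · subst hj; simpa using hasDerivAt_id' _
    · simpa [hj] using hasDerivAt_const _ _
  have hself : Function.update L e' (L e') = L := Function.update_eq_self _ _
  have hsum : HasDerivAt (fun s : ℝ => F.angleSum ρ p (Function.update L e' s) e)
      (∑ t : T, ∑ q : Fin 6,
        if F.tetEdge t (tetPairs q).1 (tetPairs q).2.1 = e then
          √(2 * L e) * (dihedralRate (fun i j => L (F.tetEdge t i j))
            (fun i j => if F.tetEdge t i j = e' then 1 else 0) (tetPairs q) /
            (2 * L e * (6 * F.signedVol ρ p t)))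
        else 0) (L e') := by
    unfold angleSum
    refine HasDerivAt.fun_sum fun t _ => HasDerivAt.fun_sum fun q _ => ?_
    split_ifs with h
    · have := hasDerivAt_sign_mul_dihedral (V := F.signedVol ρ p t)
        (M := fun s i j => Function.update L e' s (F.tetEdge t i j))
        (m := fun i j => if F.tetEdge t i j = e' then 1 else 0) (x := L e')
        (fun i j => hup _) (tetPairs q) (by simpa [hself] using hnd t q h)
      simpa only [hself, h] using this
    · exact hasDerivAt_const _ _
  have hdef := hasDerivAt_toReal_of_coe_eq_zero
    ((hasDerivAt_const (L e') (F.totalAngle ρ p e)).sub hsum) (by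
      simp only [Pi.sub_apply, hself, Real.Angle.coe_sub]
      rw [hflat, sub_self])
  have hden := ((hup e).const_mul 2).sqrt (by simp only [hself]; positivity)
  have hq := hdef.div hden (by simp only [hself]; positivity)
  have hzero : (((F.totalAngle ρ p e - F.angleSum ρ p L e : ℝ)) : Real.Angle).toReal = 0 := by
    rw [Real.Angle.coe_sub, hflat, sub_self, Real.Angle.toReal_zero]
  have hval : F.matF3 ρ p e e' = _ := hq.deriv
  rw [hval]
  simp only [Pi.sub_apply, hself, hzero]
  have hr : 0 < √(2 * L e) := Real.sqrt_pos.2 (by positivity)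
  rw [← Finset.sum_neg_distrib]
  simp only [← mul_ite_zero, ← Finset.mul_sum, zero_mul, sub_zero, zero_sub, Finset.sum_neg_distrib]
  field_simp

end FundamentalFamily
end

/-! ### Lengths and volumes in the given placement. -/

noncomputable section
namespace Trefoil

open FundamentalFamily

/-- Half the squared edge lengths of the tetrahedron with vertices `(0, 0, a)`, `(0, 0, b)` and two
points at height `0` on the unit circle, whose angle has cosine `σ`. -/
def axisShape (a b σ : ℝ) : Fin 4 → Fin 4 → ℝ :=
  edgeTable ((b - a) ^ 2 / 2) ((1 + a ^ 2) / 2) ((1 + a ^ 2) / 2) ((1 + b ^ 2) / 2)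
    ((1 + b ^ 2) / 2) (1 - σ)

/-- Every face contains either the axis edge or the chord. Its Gram determinant is `(b - a)²` in the
first case and `(1 - σ)(1 + σ + 2z²)` in the second, where `z` is the height of the axis vertex; all
are positive. -/
theorem nondegAt_axisShape {a b γ σ : ℝ} (hab : a ≠ b) (hγ : γ ≠ 0) (h1 : γ ^ 2 + σ ^ 2 = 1)
    (q : Fin 6) : NondegAt (axisShape a b σ) ((b - a) * γ / 6) (tetPairs q) := by
  have hγ2 : 0 < γ ^ 2 := by positivity
  have hσ1 : 0 < 1 - σ := by nlinarith
  have hσ2 : 0 < 1 + σ := by nlinarith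
  have hh : b - a ≠ 0 := sub_ne_zero.2 hab.symm
  have hh2 : 0 < (b - a) ^ 2 := by positivity
  have ka : 0 < (1 - σ) * (1 + σ + 2 * a ^ 2) := by positivity
  have kb : 0 < (1 - σ) * (1 + σ + 2 * b ^ 2) := by positivity
  have hg : γ ^ 2 = 1 - σ ^ 2 := by linarith
  have hV : (b - a) * γ / 6 ≠ 0 := by positivity
  have hV2 : (6 * ((b - a) * γ / 6)) ^ 2 = (b - a) ^ 2 * (1 - σ ^ 2) := by rw [← hg]; ring
  fin_cases q <;>
    simp only [NondegAt, tetPairs, faceGram, dihedralNum, axisShape, edgeTable, Fin.zero_eta,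
      Fin.mk_one, Fin.reduceFinMk, Fin.isValue, Matrix.cons_val, Matrix.cons_val_zero,
      Matrix.cons_val_one, hV2] <;>
    refine ⟨?_, ?_, ?_, hV, ?_⟩ <;>
    first
      | positivity
      | ring1
      | (refine hh2.trans_eq ?_; ring1)
      | (refine ka.trans_eq ?_; ring1)
      | (refine kb.trans_eq ?_; ring1)

theorem abelianRep_xgen (φ : ℝ) (i : Fin 3) : abelianRep φ (xgen i) = rotZ φ :=
  PresentedGroup.toGroup.of _

theorem rotZ_mul (φ ψ : ℝ) : rotZ φ * rotZ ψ = rotZ (φ + ψ) := by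
  ext x i
  change rotZ φ (rotZ ψ x) i = _
  rw [rotZ_apply, rotZ_apply, rotZ_apply, Real.cos_add, Real.sin_add]
  fin_cases i <;> simp <;> ring

theorem abelianRep_xgen_mul (φ : ℝ) (i j : Fin 3) :
    abelianRep φ (xgen i * xgen j) = rotZ (2 * φ) := by
  rw [map_mul, abelianRep_xgen, abelianRep_xgen, rotZ_mul, two_mul]

/-- The height at which a link vertex is placed. -/
def height : TrefVL → ℝ
  | .A i => i.val + 3
  | .B i => i.val

theorem placement_link (φ : ℝ) (v : TrefVL) :
    (placement φ).pos (Sum.inl v) = !₂[0, 0, height v] := by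
  cases v <;> rfl

theorem rotZ_axis (φ z : ℝ) : rotZ φ !₂[0, 0, z] = !₂[0, 0, z] := by
  rw [rotZ_apply]; ext i; fin_cases i <;> simp

theorem rotZ_O (φ : ℝ) : rotZ φ !₂[1, 0, 0] = !₂[Real.cos φ, Real.sin φ, 0] := by
  rw [rotZ_apply]; ext i; fin_cases i <;> simp

theorem half_dist_sq (x y : Pt) : dist x y ^ 2 / 2 =
    ((x 0 - y 0) ^ 2 + (x 1 - y 1) ^ 2 + (x 2 - y 2) ^ 2) / 2 := by
  rw [EuclideanSpace.dist_eq, Real.sq_sqrt (by positivity), Fin.sum_univ_three]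
  simp [Real.dist_eq, sq_abs]

/-- The two vertices on the axis of a tetrahedron of the family. -/
def axisEnds : TrefT → TrefVL × TrefVL
  | .lowA i => (.B (i - 1), .A i)
  | .lowX i => (.A i, .B i)
  | .midA i => (.A i, .B (i - 1))
  | .midX i => (.B i, .A i)
  | .midB i => (.A (i - 1), .B i)
  | .midX' i => (.B (i - 1), .A (i - 1))
  | .highB i => (.B i, .A (i - 1))
  | .highX i => (.A i, .B i)

/-- The direction of the vertex over `O` of a tetrahedron of the family. -/
def turn (φ : ℝ) : TrefT → ℝ
  | .lowA _ | .lowX _ => 0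
  | .midA _ | .midX _ | .midB _ | .midX' _ => φ
  | .highB _ | .highX _ => 2 * φ

theorem height_ne (i j : Fin 3) : height (.A i) ≠ height (.B j) := by
  have : ((j.val : ℕ) : ℝ) < 3 := by exact_mod_cast j.isLt
  have : (0 : ℝ) ≤ i.val := by positivity
  simp only [height]; linarith

theorem height_axisEnds_ne (t : TrefT) : height (axisEnds t).1 ≠ height (axisEnds t).2 := by
  cases t <;> first | exact height_ne _ _ | exact (height_ne _ _).symm

theorem image_inl (φ : ℝ) (g : TrefoilGroup) (v : TrefVL) (ψ : ℝ) (hg : abelianRep φ g = rotZ ψ) :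
    image (abelianRep φ) (placement φ) (g, Sum.inl v) = !₂[0, 0, height v] := by
  simp only [image, hg, placement_link, rotZ_axis]

theorem rotZ_zero : rotZ 0 = 1 := by
  ext x i; rw [rotZ_apply]; fin_cases i <;> simp

theorem abelianRep_one (φ : ℝ) : abelianRep φ 1 = rotZ 0 := by rw [map_one, rotZ_zero]

theorem image_vA (φ : ℝ) (i : Fin 3) :
    image (abelianRep φ) (placement φ) (vA 1 i) = !₂[0, 0, height (.A i)] :=
  image_inl φ _ _ 0 (abelianRep_one φ)

theorem image_vB (φ : ℝ) (i : Fin 3) :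
    image (abelianRep φ) (placement φ) (vB 1 i) = !₂[0, 0, height (.B i)] :=
  image_inl φ _ _ 0 (abelianRep_one φ)

theorem image_vB' (φ : ℝ) (i j : Fin 3) :
    image (abelianRep φ) (placement φ) (vB (xgen j) i) = !₂[0, 0, height (.B i)] :=
  image_inl φ _ _ φ (abelianRep_xgen φ j)

theorem image_vP (φ : ℝ) : image (abelianRep φ) (placement φ) (vP 1) = !₂[0, 1, 0] := by
  simp [image, vP, placement]

theorem image_vO (φ : ℝ) : image (abelianRep φ) (placement φ) (vO 1) = !₂[1, 0, 0] := by
  simp [image, vO, placement]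

theorem image_vO' (φ : ℝ) (j : Fin 3) : image (abelianRep φ) (placement φ) (vO (xgen j)) =
    !₂[Real.cos φ, Real.sin φ, 0] := by
  simp only [image, vO, abelianRep_xgen, placement, rotZ_O]

theorem image_vO'' (φ : ℝ) (j k : Fin 3) :
    image (abelianRep φ) (placement φ) (vO (xgen j * xgen k)) =
    !₂[Real.cos (2 * φ), Real.sin (2 * φ), 0] := by
  simp only [image, vO, abelianRep_xgen_mul, placement, rotZ_O]

/-- Rotations fix the axis, so the group label matters only for the vertex over `O`, where it
becomes the angle `turn φ t`. The angle from this vertex to `P` is therefore `π / 2 - turn φ t`,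
which is why its cosine is a sine and its sine a cosine throughout. -/
theorem image_tet (φ : ℝ) (t : TrefT) :
    (fun r => image (abelianRep φ) (placement φ) (family.tet t r)) =
      ![!₂[0, 0, height (axisEnds t).1], !₂[0, 0, height (axisEnds t).2],
        !₂[Real.cos (turn φ t), Real.sin (turn φ t), 0], !₂[0, 1, 0]] := by
  funext r
  cases t <;> fin_cases r <;>
    simp [family, tet, image_vA, image_vB, image_vB', image_vO, image_vO', image_vO'', image_vP,
      axisEnds, turn]

theorem signedVol_eq (φ : ℝ) (t : TrefT) :
    family.signedVol (abelianRep φ) (placement φ) t =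
      (height (axisEnds t).2 - height (axisEnds t).1) * Real.cos (turn φ t) / 6 := by
  have h := congrFun (image_tet φ t)
  simp only [signedVol, h]
  simp [Matrix.det_fin_three, Fin.succ]

/-- Half the squared lengths of the edges of the family. -/
def edgeHalfSq (φ : ℝ) : TrefEL ⊕ TrefEO → ℝ
  | .inl (.toA i) => (height (.A i) - height (.B (i - 1))) ^ 2 / 2
  | .inl (.toB i) => (height (.B i) - height (.A (i - 1))) ^ 2 / 2
  | .inr (.AB i) => (height (.B i) - height (.A i)) ^ 2 / 2
  | .inr (.AO i) | .inr (.AO' i) | .inr (.AP i) => (1 + height (.A i) ^ 2) / 2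
  | .inr (.BO i) | .inr (.BP i) | .inr (.BP' i) => (1 + height (.B i) ^ 2) / 2
  | .inr .OPlow => 1 - Real.sin 0
  | .inr (.OPmid _) => 1 - Real.sin φ
  | .inr .OPhigh => 1 - Real.sin (2 * φ)

theorem edgeL_eq (φ : ℝ) (e : TrefEL ⊕ TrefEO) :
    family.edgeL (abelianRep φ) (placement φ) e = edgeHalfSq φ e := by
  have h1 := Real.sin_sq_add_cos_sq φ
  have h2 := Real.sin_sq_add_cos_sq (2 * φ)
  rw [edgeL, edgeLength, half_dist_sq]
  rcases e with (i | i) | (i | i | i | i | i | i | i | _ | i | _)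
  · change ((image _ _ (vB 1 (i - 1)) 0 - image _ _ (vA 1 i) 0) ^ 2 +
      (image _ _ (vB 1 (i - 1)) 1 - image _ _ (vA 1 i) 1) ^ 2 +
      (image _ _ (vB 1 (i - 1)) 2 - image _ _ (vA 1 i) 2) ^ 2) / 2 = _
    simp [image_vA, image_vB, edgeHalfSq]; ring
  · change ((image _ _ (vA 1 (i - 1)) 0 - image _ _ (vB (xgen i) i) 0) ^ 2 +
      (image _ _ (vA 1 (i - 1)) 1 - image _ _ (vB (xgen i) i) 1) ^ 2 +
      (image _ _ (vA 1 (i - 1)) 2 - image _ _ (vB (xgen i) i) 2) ^ 2) / 2 = _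
    simp [image_vA, image_vB', edgeHalfSq]; ring
  all_goals
    simp only [FundamentalFamily.ends, edgeEnds, family, offEnds, image_vA, image_vB, image_vB',
      image_vO, image_vO', image_vO'', image_vP, edgeHalfSq]
    simp
    try grind

theorem edgeHalfSq_tet (φ : ℝ) (t : TrefT) :
    (fun i j => edgeHalfSq φ (family.tetEdge t i j)) =
      axisShape (height (axisEnds t).1) (height (axisEnds t).2) (Real.sin (turn φ t)) := by
  funext i j
  cases t <;> fin_cases i <;> fin_cases j <;>
    simp [family, tetEdge, axisShape, edgeTable, edgeHalfSq, axisEnds, turn] <;> ring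

theorem turn_cos_ne {φ : ℝ} (h1 : Real.cos φ ≠ 0) (h2 : Real.cos (2 * φ) ≠ 0) (t : TrefT) :
    Real.cos (turn φ t) ≠ 0 := by
  cases t <;> simp [turn, h1, h2]

theorem one_sub_sin_pos {ψ : ℝ} (h : Real.cos ψ ≠ 0) : 0 < 1 - Real.sin ψ := by
  have := Real.sin_sq_add_cos_sq ψ
  have : 0 < Real.cos ψ ^ 2 := by positivity
  nlinarith

theorem edgeHalfSq_pos {φ : ℝ} (h1 : Real.cos φ ≠ 0) (h2 : Real.cos (2 * φ) ≠ 0)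
    (e : TrefEL ⊕ TrefEO) : 0 < edgeHalfSq φ e := by
  have hA : ∀ i j, height (.A i) - height (.B j) ≠ 0 := fun i j => sub_ne_zero.2 (height_ne i j)
  have hB : ∀ i j, height (.B i) - height (.A j) ≠ 0 :=
    fun i j => sub_ne_zero.2 (height_ne j i).symm
  have h3 := one_sub_sin_pos h1
  have h4 := one_sub_sin_pos h2
  have h5 : 0 < 1 - Real.sin 0 := by simp
  rcases e with (i | i) | (i | i | i | i | i | i | i | _ | i | _) <;> simp only [edgeHalfSq] <;>
    first
      | assumption
      | (have := hA i (i - 1); positivity)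
      | (have := hB i (i - 1); positivity)
      | (have := hB i i; positivity)

end Trefoil
end

noncomputable section
namespace Trefoil

open FundamentalFamily

/-! ### Stars of edges -/

theorem sum_tet {M : Type*} [AddCommMonoid M] (f : TrefT → M) : ∑ t, f t = ∑ i : Fin 3,
    (f (.lowA i) + f (.lowX i) + f (.midA i) + f (.midX i) + f (.midB i) + f (.midX' i) +
      f (.highB i) + f (.highX i)) := by
  have h : (Finset.univ : Finset TrefT) = Finset.univ.biUnion fun i : Fin 3 =>
      {.lowA i, .lowX i, .midA i, .midX i, .midB i, .midX' i, .highB i, .highX i} := by decide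
  rw [h, Finset.sum_biUnion]
  · refine Finset.sum_congr rfl fun i _ => ?_
    simp [add_assoc]
  · intro i _ j _ hij
    rw [Function.onFun, Finset.disjoint_left]
    intro t h1 h2
    simp only [Finset.mem_insert, Finset.mem_singleton] at h1 h2
    rcases h1 with rfl | rfl | rfl | rfl | rfl | rfl | rfl | rfl <;> simp_all

open Classical in
/-- The sum of `f` over the corners of the tetrahedra at the edge `e`. -/
def starSum (f : TrefT → Fin 6 → ℝ) (e : TrefEL ⊕ TrefEO) : ℝ :=
  ∑ t : TrefT, ∑ q : Fin 6,
    if family.tetEdge t (tetPairs q).1 (tetPairs q).2.1 = e then f t q else 0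

section
variable (f : TrefT → Fin 6 → ℝ) (i : Fin 3)

theorem starSum_toA : starSum f (.inl (.toA i)) = f (.lowA i) 0 + f (.midA i) 0 := by
  rw [starSum, sum_tet]
  simp [Fin.sum_univ_six, family, tetEdge, tetPairs, edgeTable, Finset.sum_add_distrib]

theorem starSum_toB : starSum f (.inl (.toB i)) = f (.midB i) 0 + f (.highB i) 0 := by
  rw [starSum, sum_tet]
  simp [Fin.sum_univ_six, family, tetEdge, tetPairs, edgeTable, Finset.sum_add_distrib]

theorem starSum_AB : starSum f (.inr (.AB i)) =
    f (.lowX i) 0 + f (.midX i) 0 + f (.midX' (i + 1)) 0 + f (.highX i) 0 := by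
  rw [starSum, sum_tet]
  simp [Fin.sum_univ_six, family, tetEdge, tetPairs, edgeTable, Finset.sum_add_distrib,
    sub_eq_iff_eq_add]

/-- Here and for the other spokes, each parenthesis groups the two tetrahedra of one region that
meet at the spoke. They share a face, and cancellation takes place inside each group. -/
theorem starSum_AO : starSum f (.inr (.AO i)) =
    (f (.lowA i) 3 + f (.lowX i) 1) + (f (.midA i) 1 + f (.midX i) 3) := by
  rw [starSum, sum_tet]
  simp [Fin.sum_univ_six, family, tetEdge, tetPairs, edgeTable, Finset.sum_add_distrib]
  ring

theorem starSum_AO' : starSum f (.inr (.AO' i)) =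
    (f (.midB (i + 1)) 1 + f (.midX' (i + 1)) 3) + (f (.highB (i + 1)) 3 + f (.highX i) 1) := by
  rw [starSum, sum_tet]
  simp [Fin.sum_univ_six, family, tetEdge, tetPairs, edgeTable, Finset.sum_add_distrib,
    sub_eq_iff_eq_add]
  ring

theorem starSum_AP : starSum f (.inr (.AP i)) =
    (f (.lowA i) 4 + f (.lowX i) 2) + (f (.midA i) 2 + f (.midX i) 4) +
    (f (.midB (i + 1)) 2 + f (.midX' (i + 1)) 4) + (f (.highB (i + 1)) 4 + f (.highX i) 2) := by
  rw [starSum, sum_tet]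
  simp [Fin.sum_univ_six, family, tetEdge, tetPairs, edgeTable, Finset.sum_add_distrib,
    sub_eq_iff_eq_add]
  ring

theorem starSum_BO : starSum f (.inr (.BO i)) =
    (f (.lowA (i + 1)) 1 + f (.lowX i) 3) + (f (.midA (i + 1)) 3 + f (.midX' (i + 1)) 1) +
    (f (.midX i) 1 + f (.midB i) 3) + (f (.highB i) 1 + f (.highX i) 3) := by
  rw [starSum, sum_tet]
  simp [Fin.sum_univ_six, family, tetEdge, tetPairs, edgeTable, Finset.sum_add_distrib,
    sub_eq_iff_eq_add]
  ring

theorem starSum_BP : starSum f (.inr (.BP i)) =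
    (f (.lowA (i + 1)) 2 + f (.lowX i) 4) + (f (.midA (i + 1)) 4 + f (.midX' (i + 1)) 2) := by
  rw [starSum, sum_tet]
  simp [Fin.sum_univ_six, family, tetEdge, tetPairs, edgeTable, Finset.sum_add_distrib,
    sub_eq_iff_eq_add]
  ring

theorem starSum_BP' : starSum f (.inr (.BP' i)) =
    (f (.midX i) 2 + f (.midB i) 4) + (f (.highB i) 2 + f (.highX i) 4) := by
  rw [starSum, sum_tet]
  simp [Fin.sum_univ_six, family, tetEdge, tetPairs, edgeTable, Finset.sum_add_distrib]
  ring

theorem starSum_OPmid : starSum f (.inr (.OPmid i)) =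
    f (.midA i) 5 + f (.midX i) 5 + f (.midB i) 5 + f (.midX' i) 5 := by
  rw [starSum, sum_tet]
  simp [Fin.sum_univ_six, family, tetEdge, tetPairs, edgeTable, Finset.sum_add_distrib]

theorem starSum_OPhigh : starSum f (.inr .OPhigh) =
    ∑ i, (f (.highB i) 5 + f (.highX i) 5) := by
  rw [starSum, sum_tet]
  simp [Fin.sum_univ_six, family, tetEdge, tetPairs, edgeTable, Finset.sum_add_distrib]

end

/-! ### Dihedral angles -/

/-- All overpass points lie above all underpass points. This tells which way each tetrahedron runs
along the axis, hence the sign of its volume up to that of `cos (turn φ t)`. -/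
theorem height_lt (i j : Fin 3) : height (.B j) < height (.A i) := by
  have : ((j.val : ℕ) : ℝ) < 3 := by exact_mod_cast j.isLt
  have : (0 : ℝ) ≤ i.val := by positivity
  simp only [height]; linarith

/-- The dihedral angle at an edge from the axis at height `z` to the unit circle, where `s` is the
sign of the direction along the axis in which the tetrahedron extends. -/
def spokeAngle (z σ s : ℝ) : ℝ :=
  Real.arccos (-(s * z * (1 - σ)) / √((1 - σ) * (1 + σ + 2 * z ^ 2)))

theorem sqrt_sq_mul_div {h : ℝ} (z x y : ℝ) (hh : h ≠ 0) :
    -(h * z * x) / √(h ^ 2 * y) = -(Real.sign h * z * x) / √y := by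
  rw [Real.sqrt_mul (by positivity), Real.sqrt_sq_eq_abs]
  rcases lt_or_gt_of_ne hh with h1 | h1
  · rw [Real.sign_of_neg h1, abs_of_neg h1]
    field_simp
  · rw [Real.sign_of_pos h1, abs_of_pos h1]
    field_simp

/-- One of the two faces at a spoke lies in the plane through the axis. So the angle depends on the
other axis vertex only through the direction in which it lies. -/
theorem dihedral_axisShape_spoke {a b : ℝ} (hab : a ≠ b) (σ : ℝ) :
    dihedral (axisShape a b σ) (tetPairs 1) = spokeAngle a σ (Real.sign (b - a)) ∧
    dihedral (axisShape a b σ) (tetPairs 2) = spokeAngle a σ (Real.sign (b - a)) ∧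
    dihedral (axisShape a b σ) (tetPairs 3) = spokeAngle b σ (Real.sign (a - b)) ∧
    dihedral (axisShape a b σ) (tetPairs 4) = spokeAngle b σ (Real.sign (a - b)) := by
  have h1 : b - a ≠ 0 := sub_ne_zero.2 hab.symm
  have h2 : a - b ≠ 0 := sub_ne_zero.2 hab
  have key1 := sqrt_sq_mul_div a (1 - σ) ((1 - σ) * (1 + σ + 2 * a ^ 2)) h1
  have key2 := sqrt_sq_mul_div b (1 - σ) ((1 - σ) * (1 + σ + 2 * b ^ 2)) h2
  refine ⟨?_, ?_, ?_, ?_⟩ <;>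
    simp only [dihedral_eq, spokeAngle, tetPairs, faceGram, dihedralNum, axisShape, edgeTable,
      Fin.isValue, Matrix.cons_val, Matrix.cons_val_zero, Matrix.cons_val_one]
  · congr 1; rw [← key1]; congr 2 <;> ring
  · congr 1; rw [← key1]; congr 2 <;> ring
  · congr 1; rw [← key2]; congr 2 <;> ring
  · congr 1; rw [← key2]; congr 2 <;> ring

theorem dihedral_axisShape_axis {a b : ℝ} (hab : a ≠ b) (σ : ℝ) :
    dihedral (axisShape a b σ) (tetPairs 0) = Real.arccos σ := by
  have h1 : b - a ≠ 0 := sub_ne_zero.2 hab.symm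
  simp only [dihedral_eq, tetPairs, faceGram, dihedralNum, axisShape, edgeTable,
    Fin.isValue, Matrix.cons_val, Matrix.cons_val_zero, Matrix.cons_val_one]
  congr 1
  have : ∀ x y : ℝ, x = (b - a) ^ 2 * σ → y = ((b - a) ^ 2) ^ 2 → x / √y = σ := by
    rintro x y rfl rfl
    rw [Real.sqrt_sq (by positivity)]; field_simp
  exact this _ _ (by ring) (by ring)

/-- The inclination of the point at height `z` on the axis, seen from the middle of a chord of the
unit circle and measured in the plane orthogonal to the chord. -/
def inclination (σ z : ℝ) : ℝ := Real.arctan (√(2 / (1 + σ)) * z)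

theorem inclination_strictMono {σ : ℝ} (h : -1 < σ) : StrictMono (inclination σ) := by
  intro x y hxy
  have : 0 < √(2 / (1 + σ)) := Real.sqrt_pos.2 (div_pos two_pos (by linarith))
  exact Real.arctan_strictMono (mul_lt_mul_of_pos_left hxy this)

/-- The plane orthogonal to the chord at its midpoint contains the axis, and the midpoint is at
distance `√((1 + σ) / 2)` from it. In this plane the dihedral angle is the angle between the
directions to the two axis points. -/
theorem dihedral_axisShape_chord (a b : ℝ) {σ : ℝ} (h1 : -1 < σ) (h2 : σ < 1) :
    dihedral (axisShape a b σ) (tetPairs 5) = |inclination σ b - inclination σ a| := by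
  have hp1 : 0 < 1 + σ := by linarith
  have hp2 : 0 < 1 - σ := by linarith
  have hk : √(2 / (1 + σ)) ^ 2 = 2 / (1 + σ) := Real.sq_sqrt (by positivity)
  have hcos : Real.cos (inclination σ b - inclination σ a) =
      ((1 - σ) * (1 + σ + 2 * a * b)) /
        √(((1 - σ) * (1 + σ + 2 * a ^ 2)) * ((1 - σ) * (1 + σ + 2 * b ^ 2))) := by
    rw [Real.cos_sub, inclination, inclination, Real.cos_arctan, Real.cos_arctan, Real.sin_arctan,
      Real.sin_arctan]
    simp only [mul_pow, hk]
    have e : ∀ z : ℝ, 1 + 2 / (1 + σ) * z ^ 2 = (1 + σ + 2 * z ^ 2) / (1 + σ) := by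
      intro z; field_simp
    rw [e, e, Real.sqrt_mul (by positivity), Real.sqrt_mul hp2.le, Real.sqrt_mul hp2.le,
      Real.sqrt_div (by positivity), Real.sqrt_div (by positivity)]
    have ha : 0 < √(1 + σ + 2 * a ^ 2) := Real.sqrt_pos.2 (by positivity)
    have hb : 0 < √(1 + σ + 2 * b ^ 2) := Real.sqrt_pos.2 (by positivity)
    have hs1 : 0 < √(1 + σ) := Real.sqrt_pos.2 hp1
    have hs2 : 0 < √(1 - σ) := Real.sqrt_pos.2 hp2
    have hs1' : √(1 + σ) ^ 2 = 1 + σ := Real.sq_sqrt hp1.le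
    have hs2' : √(1 - σ) ^ 2 = 1 - σ := Real.sq_sqrt hp2.le
    have hk2 : √(2 / (1 + σ)) ^ 2 * √(1 + σ) ^ 2 = 2 := by rw [hk, hs1']; field_simp
    generalize √(2 / (1 + σ)) = k at *
    field_simp
    rw [hs2']
    linear_combination (1 - σ) * a * b * hk2 + (1 - σ) * hs1'
  have habs : |inclination σ b - inclination σ a| ≤ Real.pi := by
    have l1 := Real.neg_pi_div_two_lt_arctan (√(2 / (1 + σ)) * a)
    have l2 := Real.arctan_lt_pi_div_two (√(2 / (1 + σ)) * a)
    have l3 := Real.neg_pi_div_two_lt_arctan (√(2 / (1 + σ)) * b)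
    have l4 := Real.arctan_lt_pi_div_two (√(2 / (1 + σ)) * b)
    rw [abs_le, inclination, inclination]
    constructor <;> linarith
  rw [← Real.arccos_cos (abs_nonneg _) habs, Real.cos_abs, hcos]
  simp only [dihedral_eq, tetPairs, faceGram, dihedralNum, axisShape, edgeTable,
    Fin.isValue, Matrix.cons_val, Matrix.cons_val_zero, Matrix.cons_val_one]
  congr 3
  · ring
  · ring

/-! ### The signed angles and flatness -/

/-- The signed dihedral angles of the tetrahedra of the family. -/
def signedAngle (φ : ℝ) (t : TrefT) (q : Fin 6) : ℝ :=
  Real.sign (family.signedVol (abelianRep φ) (placement φ) t) *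
    dihedral (axisShape (height (axisEnds t).1) (height (axisEnds t).2) (Real.sin (turn φ t)))
      (tetPairs q)

theorem angleSum_eq (φ : ℝ) (e : TrefEL ⊕ TrefEO) :
    family.angleSum (abelianRep φ) (placement φ)
      (family.edgeL (abelianRep φ) (placement φ)) e = starSum (signedAngle φ) e := by
  simp only [angleSum, starSum, signedAngle, edgeL_eq, edgeHalfSq_tet]

theorem sign_mul_div_six {h : ℝ} (γ : ℝ) : (0 < h → Real.sign (h * γ / 6) = Real.sign γ) ∧
    (h < 0 → Real.sign (h * γ / 6) = -Real.sign γ) := by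
  constructor <;> intro hh <;> rcases lt_trichotomy γ 0 with h1 | h1 | h1
  · rw [Real.sign_of_neg h1, Real.sign_of_neg (by have := mul_neg_of_pos_of_neg hh h1; linarith)]
  · simp [h1]
  · rw [Real.sign_of_pos h1, Real.sign_of_pos (by positivity)]
  · rw [Real.sign_of_neg h1, Real.sign_of_pos (by have := mul_pos_of_neg_of_neg hh h1; linarith)]
    simp
  · simp [h1]
  · rw [Real.sign_of_pos h1, Real.sign_of_neg (by have := mul_neg_of_neg_of_pos hh h1; linarith)]

theorem signedAngle_up {φ : ℝ} {t : TrefT}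
    (h : height (axisEnds t).1 < height (axisEnds t).2) :
    signedAngle φ t 0 = Real.sign (Real.cos (turn φ t)) * Real.arccos (Real.sin (turn φ t)) ∧
    signedAngle φ t 1 = Real.sign (Real.cos (turn φ t)) *
      spokeAngle (height (axisEnds t).1) (Real.sin (turn φ t)) 1 ∧
    signedAngle φ t 2 = Real.sign (Real.cos (turn φ t)) *
      spokeAngle (height (axisEnds t).1) (Real.sin (turn φ t)) 1 ∧
    signedAngle φ t 3 = Real.sign (Real.cos (turn φ t)) *
      spokeAngle (height (axisEnds t).2) (Real.sin (turn φ t)) (-1) ∧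
    signedAngle φ t 4 = Real.sign (Real.cos (turn φ t)) *
      spokeAngle (height (axisEnds t).2) (Real.sin (turn φ t)) (-1) := by
  have hs := dihedral_axisShape_spoke h.ne (Real.sin (turn φ t))
  rw [Real.sign_of_pos (sub_pos.2 h), Real.sign_of_neg (sub_neg.2 h)] at hs
  simp only [signedAngle, signedVol_eq, (sign_mul_div_six _).1 (sub_pos.2 h), hs,
    dihedral_axisShape_axis h.ne, and_self]

theorem signedAngle_down {φ : ℝ} {t : TrefT}
    (h : height (axisEnds t).2 < height (axisEnds t).1) :
    signedAngle φ t 0 = -(Real.sign (Real.cos (turn φ t)) * Real.arccos (Real.sin (turn φ t))) ∧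
    signedAngle φ t 1 = -(Real.sign (Real.cos (turn φ t)) *
      spokeAngle (height (axisEnds t).1) (Real.sin (turn φ t)) (-1)) ∧
    signedAngle φ t 2 = -(Real.sign (Real.cos (turn φ t)) *
      spokeAngle (height (axisEnds t).1) (Real.sin (turn φ t)) (-1)) ∧
    signedAngle φ t 3 = -(Real.sign (Real.cos (turn φ t)) *
      spokeAngle (height (axisEnds t).2) (Real.sin (turn φ t)) 1) ∧
    signedAngle φ t 4 = -(Real.sign (Real.cos (turn φ t)) *
      spokeAngle (height (axisEnds t).2) (Real.sin (turn φ t)) 1) := by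
  have hs := dihedral_axisShape_spoke h.ne' (Real.sin (turn φ t))
  rw [Real.sign_of_pos (sub_pos.2 h), Real.sign_of_neg (sub_neg.2 h)] at hs
  simp only [signedAngle, signedVol_eq, (sign_mul_div_six _).2 (sub_neg.2 h), hs,
    dihedral_axisShape_axis h.ne', and_self, neg_mul]

theorem abs_sin_lt_one {ψ : ℝ} (h : Real.cos ψ ≠ 0) : -1 < Real.sin ψ ∧ Real.sin ψ < 1 := by
  have := Real.sin_sq_add_cos_sq ψ
  have : 0 < Real.cos ψ ^ 2 := by positivity
  constructor <;> nlinarith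

theorem signedAngle_chord {φ : ℝ} {t : TrefT} (h : Real.cos (turn φ t) ≠ 0) :
    signedAngle φ t 5 = Real.sign (Real.cos (turn φ t)) *
      (inclination (Real.sin (turn φ t)) (height (axisEnds t).2) -
        inclination (Real.sin (turn φ t)) (height (axisEnds t).1)) := by
  obtain ⟨h1, h2⟩ := abs_sin_lt_one h
  have hm := inclination_strictMono h1
  rw [signedAngle, signedVol_eq, dihedral_axisShape_chord _ _ h1 h2]
  rcases lt_or_gt_of_ne (height_axisEnds_ne t) with h3 | h3
  · rw [(sign_mul_div_six _).1 (sub_pos.2 h3), abs_of_pos (sub_pos.2 (hm h3))]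
  · rw [(sign_mul_div_six _).2 (sub_neg.2 h3), abs_of_neg (sub_neg.2 (hm h3))]; ring

/-- The sign converts the unoriented angle between the circle points into the oriented one, which is
additive modulo 2π. The sine and cosine of both sides agree. -/
theorem coe_sign_mul_arccos_sin {ψ : ℝ} (h : Real.cos ψ ≠ 0) :
    ((Real.sign (Real.cos ψ) * Real.arccos (Real.sin ψ) : ℝ) : Real.Angle) =
      ((Real.pi / 2 - ψ : ℝ) : Real.Angle) := by
  obtain ⟨h1, h2⟩ := abs_sin_lt_one h
  have h3 : √(1 - Real.sin ψ ^ 2) = |Real.cos ψ| := by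
    rw [← Real.sqrt_sq_eq_abs, Real.cos_sq']
  apply Real.Angle.cos_sin_inj
  · rcases lt_or_gt_of_ne h with h0 | h0
    · rw [Real.sign_of_neg h0, neg_one_mul, Real.cos_neg, Real.cos_arccos h1.le h2.le,
        Real.cos_pi_div_two_sub]
    · rw [Real.sign_of_pos h0, one_mul, Real.cos_arccos h1.le h2.le, Real.cos_pi_div_two_sub]
  · rcases lt_or_gt_of_ne h with h0 | h0
    · rw [Real.sign_of_neg h0, neg_one_mul, Real.sin_neg, Real.sin_arccos, h3, abs_of_neg h0,
        Real.sin_pi_div_two_sub, neg_neg]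
    · rw [Real.sign_of_pos h0, one_mul, Real.sin_arccos, h3, abs_of_pos h0,
        Real.sin_pi_div_two_sub]

/-- Around axis edges the oriented angles add up, at spokes the angles cancel in pairs within each
region, and at chords the inclinations telescope around the region. The chord `OPlow` belongs to
`𝓑₂`, so its row of f₃ is not needed. -/
theorem angleSum_flat {φ : ℝ} (h1 : Real.cos φ ≠ 0) (h2 : Real.cos (2 * φ) ≠ 0)
    (e : TrefEL ⊕ TrefEO) (he : e ≠ .inr .OPlow) :
    (family.angleSum (abelianRep φ) (placement φ)
      (family.edgeL (abelianRep φ) (placement φ)) e : Real.Angle) =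
      (family.totalAngle (abelianRep φ) (placement φ) e : ℝ) := by
  have h0 : Real.cos 0 ≠ 0 := by simp
  have c0 := coe_sign_mul_arccos_sin h0
  have c1 := coe_sign_mul_arccos_sin h1
  have c2 := coe_sign_mul_arccos_sin h2
  have lowA i := signedAngle_up (φ := φ) (t := .lowA i) (height_lt _ _)
  have lowX i := signedAngle_down (φ := φ) (t := .lowX i) (height_lt _ _)
  have midA i := signedAngle_down (φ := φ) (t := .midA i) (height_lt _ _)
  have midX i := signedAngle_up (φ := φ) (t := .midX i) (height_lt _ _)
  have midB i := signedAngle_down (φ := φ) (t := .midB i) (height_lt _ _)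
  have midX' i := signedAngle_up (φ := φ) (t := .midX' i) (height_lt _ _)
  have highB i := signedAngle_up (φ := φ) (t := .highB i) (height_lt _ _)
  have highX i := signedAngle_down (φ := φ) (t := .highX i) (height_lt _ _)
  have chord t := signedAngle_chord (turn_cos_ne h1 h2 t)
  rw [angleSum_eq]
  simp only [axisEnds, turn] at lowA lowX midA midX midB midX' highB highX
  rcases e with (i | i) | (i | i | i | i | i | i | i | _ | i | _)
  -- The edge points upwards, and the angles give `π/2 - (π/2 - φ) = φ`.
  · have ht : family.totalAngle (abelianRep φ) (placement φ) (.inl (.toA i)) = φ := by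
      have hl := height_lt i (i - 1)
      have : family.totalAngle (abelianRep φ) (placement φ) (.inl (.toA i)) =
        Real.sign (inner ℝ ((abelianRep φ 1).linearIsometryEquiv !₂[0, 0, 1])
          (image (abelianRep φ) (placement φ) (vA 1 i) -
            image (abelianRep φ) (placement φ) (vB 1 (i - 1)))) * φ := rfl
      rw [this, image_vA, image_vB, map_one]
      have e1 : ((1 : Motion).linearIsometryEquiv !₂[(0 : ℝ), 0, 1] : Pt) = !₂[0, 0, 1] := rfl
      rw [e1, Real.sign_of_pos, one_mul]
      simp [PiLp.inner_apply, Fin.sum_univ_three, hl]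
    rw [ht, starSum_toA, (lowA i).1, (midA i).1, Real.Angle.coe_add, Real.Angle.coe_neg, c0, c1,
      ← Real.Angle.coe_neg, ← Real.Angle.coe_add]
    congr 1; ring
  -- The edge points downwards, and the angles give `-(π/2 - φ) + (π/2 - 2φ) = -φ`.
  · have ht : family.totalAngle (abelianRep φ) (placement φ) (.inl (.toB i)) = -φ := by
      have hl := height_lt (i - 1) i
      have : family.totalAngle (abelianRep φ) (placement φ) (.inl (.toB i)) =
        Real.sign (inner ℝ ((abelianRep φ 1).linearIsometryEquiv !₂[0, 0, 1])
          (image (abelianRep φ) (placement φ) (vB (xgen i) i) -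
            image (abelianRep φ) (placement φ) (vA 1 (i - 1)))) * φ := rfl
      rw [this, image_vA, image_vB', map_one]
      have e1 : ((1 : Motion).linearIsometryEquiv !₂[(0 : ℝ), 0, 1] : Pt) = !₂[0, 0, 1] := rfl
      rw [e1, Real.sign_of_neg, neg_one_mul]
      simp [PiLp.inner_apply, Fin.sum_univ_three, hl]
    rw [ht, starSum_toB, (midB i).1, (highB i).1, Real.Angle.coe_add, Real.Angle.coe_neg, c1, c2,
      ← Real.Angle.coe_neg, ← Real.Angle.coe_add]
    congr 1; ring
  all_goals
    change _ = ((2 * Real.pi : ℝ) : Real.Angle)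
    rw [Real.Angle.coe_two_pi]
  -- The four regions at a crossing give `-π/2 + 2(π/2 - φ) - (π/2 - 2φ) = 0`.
  · rw [starSum_AB, (lowX i).1, (midX i).1, (midX' (i + 1)).1, (highX i).1]
    simp only [Real.Angle.coe_add, Real.Angle.coe_neg, c0, c1, c2]
    simp only [← Real.Angle.coe_neg, ← Real.Angle.coe_add]
    rw [← Real.Angle.coe_zero]
    congr 1; ring
  · rw [starSum_AO]; simp [lowA, lowX, midA, midX]
  · rw [starSum_AO']; simp [midB, midX', highB, highX]
  · rw [starSum_AP]; simp [lowA, lowX, midA, midX, midB, midX', highB, highX]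
  · rw [starSum_BO]; simp [lowA, lowX, midA, midX, midB, midX', highB, highX]
  · rw [starSum_BP]; simp [lowA, lowX, midA, midX']
  · rw [starSum_BP']; simp [midX, midB, highB, highX]
  · exact absurd rfl he
  · rw [starSum_OPmid, ← Real.Angle.coe_zero]; simp only [chord, axisEnds, turn]
    congr 1; ring
  · rw [starSum_OPhigh, ← Real.Angle.coe_zero]; simp only [chord, axisEnds, turn]
    congr 1
    have h3 : (-1 : Fin 3) = 2 := rfl
    simp [Fin.sum_univ_three, h3]
    ring

end Trefoil
end

noncomputable section
namespace Trefoil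

open FundamentalFamily

/-! ### Derivatives of the dihedral angles -/

/-- The derivative of a signed dihedral angle, divided by the length of its edge. -/
def cornerRate (a b γ σ : ℝ) (m : Fin 4 → Fin 4 → ℝ) (q : Fin 6) : ℝ :=
  dihedralRate (axisShape a b σ) m (tetPairs q) /
    (2 * axisShape a b σ (tetPairs q).1 (tetPairs q).2.1 * ((b - a) * γ))

/-- The part of `cornerRate` at a spoke that depends only on the triangle spanned by the point of
the axis and the two points of the circle. -/
def spokeRate (z γ σ m1 m2 m3 : ℝ) : ℝ :=
  -(z / ((1 + z ^ 2) * γ) * (-σ * m1 + m2 - m3 +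
    ((1 - σ) * (m1 + m2) + (z ^ 2 + σ) * m3) / (1 + σ + 2 * z ^ 2)))

/-- The part of `cornerRate` at a chord that depends only on the triangle spanned by a point of
the axis and the chord. -/
def chordRate (z γ σ m1 m3 : ℝ) : ℝ :=
  z / (γ * (1 + σ + 2 * z ^ 2)) * (m1 - m3 / 2)

/-- Only the chord is varied, since this is all that the blocks next to the zero blocks require. -/
theorem cornerRate_axis {a b γ : ℝ} (hab : a ≠ b) (hγ : γ ≠ 0) (σ m23 : ℝ) :
    cornerRate a b γ σ (edgeTable 0 0 0 0 0 m23) 0 = m23 / ((b - a) * γ) := by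
  have hh : b - a ≠ 0 := sub_ne_zero.2 hab.symm
  simp only [cornerRate, dihedralRate, dihedralNumRate, faceGramRate, tetPairs, faceGram,
    dihedralNum, axisShape, edgeTable, Fin.isValue, Matrix.cons_val, Matrix.cons_val_zero,
    Matrix.cons_val_one]
  field_simp
  ring

/-- The splitting isolates `spokeRate`, which involves only the face spanned by the spoke and the
chord. The adjacent tetrahedron of the same region has the same face term with the opposite sign.
The chord variation `m23` occurs nowhere else, so it drops out of spoke rows. -/
theorem cornerRate_spoke1 {a b γ σ : ℝ} (hab : a ≠ b) (hγ : γ ≠ 0) (h1 : γ ^ 2 + σ ^ 2 = 1)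
    (m01 m02 m03 m12 m13 m23 : ℝ) :
    cornerRate a b γ σ (edgeTable m01 m02 m03 m12 m13 m23) 1 =
      (σ * (m02 - m12) - (m03 - m13) - (1 - σ) * (b / (b - a)) * m01) / ((b - a) * γ) +
        spokeRate a γ σ m02 m03 m23 := by
  have hγ2 : 0 < γ ^ 2 := by positivity
  have hσ1 : 0 < 1 - σ := by nlinarith
  have hσ2 : 0 < 1 + σ := by nlinarith
  have hh : b - a ≠ 0 := sub_ne_zero.2 hab.symm
  have ka : 0 < 1 + σ + 2 * a ^ 2 := by positivity
  have e1 : faceGram (axisShape a b σ) 0 2 1 = (b - a) ^ 2 := by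
    simp [faceGram, axisShape, edgeTable]; ring
  have e2 : faceGram (axisShape a b σ) 0 2 3 = (1 - σ) * (1 + σ + 2 * a ^ 2) := by
    simp [faceGram, axisShape, edgeTable]; ring
  simp only [cornerRate, dihedralRate, tetPairs, Fin.isValue, Matrix.cons_val_zero,
    Matrix.cons_val_one, e1, e2]
  simp only [dihedralNumRate, faceGramRate, spokeRate,
    dihedralNum, axisShape, edgeTable, Fin.isValue, Matrix.cons_val, Matrix.cons_val_zero,
    Matrix.cons_val_one]
  field_simp
  ring

theorem cornerRate_spoke2 {a b γ σ : ℝ} (hab : a ≠ b) (hγ : γ ≠ 0) (h1 : γ ^ 2 + σ ^ 2 = 1)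
    (m01 m02 m03 m12 m13 m23 : ℝ) :
    cornerRate a b γ σ (edgeTable m01 m02 m03 m12 m13 m23) 2 =
      (σ * (m03 - m13) - (m02 - m12) - (1 - σ) * (b / (b - a)) * m01) / ((b - a) * γ) +
        spokeRate a γ σ m03 m02 m23 := by
  rw [← cornerRate_spoke1 hab hγ h1 m01 m03 m02 m13 m12 m23]
  simp only [cornerRate, dihedralRate, dihedralNumRate, faceGramRate, tetPairs, faceGram,
    dihedralNum, axisShape, edgeTable, Fin.isValue, Matrix.cons_val, Matrix.cons_val_zero,
    Matrix.cons_val_one]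

/-- Exchanging the two axis vertices reverses the orientation. This is the source of the minus sign
before `spokeRate`, and thus of the cancellation. -/
theorem cornerRate_spoke3 {a b γ σ : ℝ} (hab : a ≠ b) (hγ : γ ≠ 0) (h1 : γ ^ 2 + σ ^ 2 = 1)
    (m01 m02 m03 m12 m13 m23 : ℝ) :
    cornerRate a b γ σ (edgeTable m01 m02 m03 m12 m13 m23) 3 =
      (σ * (m12 - m02) - (m13 - m03) + (1 - σ) * (a / (b - a)) * m01) / ((b - a) * γ) -
        spokeRate b γ σ m12 m13 m23 := by
  have h := cornerRate_spoke1 hab.symm hγ h1 m01 m12 m13 m02 m03 m23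
  have e : cornerRate a b γ σ (edgeTable m01 m02 m03 m12 m13 m23) 3 =
      -cornerRate b a γ σ (edgeTable m01 m12 m13 m02 m03 m23) 1 := by
    have e3 : (a - b) ^ 2 = (b - a) ^ 2 := by ring
    simp only [cornerRate, dihedralRate, dihedralNumRate, faceGramRate, tetPairs, faceGram,
      dihedralNum, axisShape, edgeTable, Fin.isValue, Matrix.cons_val, Matrix.cons_val_zero,
      Matrix.cons_val_one, e3]
    rw [← neg_sub b a, neg_mul, mul_neg, div_neg, neg_neg]
  rw [e, h]
  have h2 : a / (a - b) = -(a / (b - a)) := by rw [← neg_sub b a, div_neg]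
  rw [h2, ← neg_sub b a, neg_mul, div_neg]
  ring

theorem cornerRate_spoke4 {a b γ σ : ℝ} (hab : a ≠ b) (hγ : γ ≠ 0) (h1 : γ ^ 2 + σ ^ 2 = 1)
    (m01 m02 m03 m12 m13 m23 : ℝ) :
    cornerRate a b γ σ (edgeTable m01 m02 m03 m12 m13 m23) 4 =
      (σ * (m13 - m03) - (m12 - m02) + (1 - σ) * (a / (b - a)) * m01) / ((b - a) * γ) -
        spokeRate b γ σ m13 m12 m23 := by
  rw [← cornerRate_spoke3 hab hγ h1 m01 m03 m02 m13 m12 m23]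
  simp only [cornerRate, dihedralRate, dihedralNumRate, faceGramRate, tetPairs, faceGram,
    dihedralNum, axisShape, edgeTable, Fin.isValue, Matrix.cons_val, Matrix.cons_val_zero,
    Matrix.cons_val_one]

/-- Apart from the axis term this is a difference of one function of a face at its two axis
vertices, as the angle itself is a difference of inclinations. -/
theorem cornerRate_chord {a b γ σ : ℝ} (hab : a ≠ b) (hγ : γ ≠ 0) (h1 : γ ^ 2 + σ ^ 2 = 1)
    (m01 m02 m03 m12 m13 m23 : ℝ) :
    cornerRate a b γ σ (edgeTable m01 m02 m03 m12 m13 m23) 5 =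
      m01 / ((b - a) * γ) + chordRate a γ σ (m02 + m03) m23 - chordRate b γ σ (m12 + m13) m23 := by
  have hγ2 : 0 < γ ^ 2 := by positivity
  have hσ1 : 0 < 1 - σ := by nlinarith
  have hσ2 : 0 < 1 + σ := by nlinarith
  have hh : b - a ≠ 0 := sub_ne_zero.2 hab.symm
  have ka : 0 < 1 + σ + 2 * a ^ 2 := by positivity
  have kb : 0 < 1 + σ + 2 * b ^ 2 := by positivity
  have e1 : faceGram (axisShape a b σ) 2 3 0 = (1 - σ) * (1 + σ + 2 * a ^ 2) := by
    simp [faceGram, axisShape, edgeTable]; ring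
  have e2 : faceGram (axisShape a b σ) 2 3 1 = (1 - σ) * (1 + σ + 2 * b ^ 2) := by
    simp [faceGram, axisShape, edgeTable]; ring
  simp only [cornerRate, dihedralRate, tetPairs, Fin.isValue, Matrix.cons_val, e1, e2]
  simp only [dihedralNumRate, faceGramRate, chordRate,
    dihedralNum, axisShape, edgeTable, Fin.isValue, Matrix.cons_val, Matrix.cons_val_zero,
    Matrix.cons_val_one]
  field_simp
  ring

/-- The derivatives of the signed angles of the tetrahedra of the family along `δ`. -/
def tetRate (φ : ℝ) (δ : TrefEL ⊕ TrefEO → ℝ) (t : TrefT) (q : Fin 6) : ℝ :=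
  cornerRate (height (axisEnds t).1) (height (axisEnds t).2) (Real.cos (turn φ t))
    (Real.sin (turn φ t)) (fun i j => δ (family.tetEdge t i j)) q

theorem matF3_eq {φ : ℝ} (h1 : Real.cos φ ≠ 0) (h2 : Real.cos (2 * φ) ≠ 0)
    (e e' : TrefEL ⊕ TrefEO) (he : e ≠ .inr .OPlow) :
    family.matF3 (abelianRep φ) (placement φ) e e' =
      -starSum (tetRate φ fun j => if j = e' then 1 else 0) e := by
  rw [matF3_apply _ _ _ _ _ _ (by rw [edgeL_eq]; exact edgeHalfSq_pos h1 h2 e)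
    (angleSum_flat h1 h2 e he)]
  · rw [starSum]
    congr 1
    refine Finset.sum_congr rfl fun t _ => Finset.sum_congr rfl fun q _ => ?_
    split_ifs with h
    · have hM := edgeHalfSq_tet φ t
      have hM' := congrFun (congrFun hM (tetPairs q).1) (tetPairs q).2.1
      simp only [edgeL_eq, hM, signedVol_eq, tetRate, cornerRate]
      rw [← hM']
      simp only [h]
      congr 1
      · congr 1
        funext i j
        split_ifs <;> rfl
      · ring
    · rfl
  · intro t q _
    simp only [edgeL_eq, edgeHalfSq_tet, signedVol_eq]
    exact nondegAt_axisShape (height_axisEnds_ne t) (turn_cos_ne h1 h2 t)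
      (Real.cos_sq_add_sin_sq _) q

theorem comp_edgeTable {E F : Type} (f : E → F) (e01 e02 e03 e12 e13 e23 : E) :
    (fun i j => f (edgeTable e01 e02 e03 e12 e13 e23 i j)) =
      edgeTable (f e01) (f e02) (f e03) (f e12) (f e13) (f e23) := by
  funext i j
  fin_cases i <;> fin_cases j <;> rfl

end Trefoil
end

noncomputable section
namespace Trefoil

open FundamentalFamily

/-! ### The rows of `f₃` -/

theorem tetEdge_eq_edgeTable (δ : TrefEL ⊕ TrefEO → ℝ) (t : TrefT) :
    (fun i j => δ (family.tetEdge t i j)) = edgeTable (δ (tetEdge t 0 1)) (δ (tetEdge t 0 2))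
      (δ (tetEdge t 0 3)) (δ (tetEdge t 1 2)) (δ (tetEdge t 1 3)) (δ (tetEdge t 2 3)) := by
  cases t <;> exact comp_edgeTable δ _ _ _ _ _ _

section
variable {φ : ℝ} (δ : TrefEL ⊕ TrefEO → ℝ) (i : Fin 3)

/-- The `chordRate` terms telescope around the boundary of the region, so only variations of axis
edges survive. The same happens for `OPhigh`. -/
theorem starSum_tetRate_OPmid (h1 : Real.cos φ ≠ 0) (h2 : Real.cos (2 * φ) ≠ 0) :
    starSum (tetRate φ δ) (.inr (.OPmid i)) =
      -δ (.inl (.toA i)) / ((height (.A i) - height (.B (i - 1))) * Real.cos φ) +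
      δ (.inr (.AB i)) / ((height (.A i) - height (.B i)) * Real.cos φ) -
      δ (.inl (.toB i)) / ((height (.A (i - 1)) - height (.B i)) * Real.cos φ) +
      δ (.inr (.AB (i - 1))) /
        ((height (.A (i - 1)) - height (.B (i - 1))) * Real.cos φ) := by
  have h t := cornerRate_chord (height_axisEnds_ne t) (turn_cos_ne h1 h2 t)
    (Real.cos_sq_add_sin_sq _)
  rw [starSum_OPmid]
  simp only [tetRate, tetEdge_eq_edgeTable, h]
  simp only [axisEnds, turn, tetEdge, edgeTable, Fin.isValue, Matrix.cons_val,
    Matrix.cons_val_zero, Matrix.cons_val_one]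
  rw [← neg_sub (height (.A i)) (height (.B (i - 1))),
    ← neg_sub (height (.A (i - 1))) (height (.B i))]
  simp only [neg_mul, div_neg]
  ring

theorem starSum_tetRate_OPhigh (h1 : Real.cos φ ≠ 0) (h2 : Real.cos (2 * φ) ≠ 0) :
    starSum (tetRate φ δ) (.inr .OPhigh) = ∑ i : Fin 3,
      (δ (.inl (.toB i)) / ((height (.A (i - 1)) - height (.B i)) * Real.cos (2 * φ)) -
      δ (.inr (.AB i)) / ((height (.A i) - height (.B i)) * Real.cos (2 * φ))) := by
  have h t := cornerRate_chord (height_axisEnds_ne t) (turn_cos_ne h1 h2 t)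
    (Real.cos_sq_add_sin_sq _)
  have h3 : (-1 : Fin 3) = 2 := rfl
  rw [starSum_OPhigh]
  simp only [tetRate, tetEdge_eq_edgeTable, h]
  simp only [axisEnds, turn, tetEdge, edgeTable, Fin.isValue, Matrix.cons_val,
    Matrix.cons_val_zero, Matrix.cons_val_one]
  simp only [← neg_sub (height (.A _)) (height (.B _)), neg_mul, div_neg]
  simp [Fin.sum_univ_three, h3]
  ring

/-- Changes of the lengths of the edges `OPmid` and `OPhigh`. -/
def chordExt (y : Fin 4 → ℝ) : TrefEL ⊕ TrefEO → ℝ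
  | .inr (.OPmid i) => ![y 0, y 1, y 2] i
  | .inr .OPhigh => y 3
  | _ => 0

/-- Changes of the lengths of the edges on the axis which are not in `𝓑₂`. -/
def axisExt (y : Fin 4 → ℝ) : TrefEL ⊕ TrefEO → ℝ
  | .inr (.AB i) => ![y 0, y 1, y 2] i
  | .inl (.toB i) => ![0, 0, y 3] i
  | _ => 0

/-- Changes of the lengths of the edges from the axis to the circle which are not in `𝓑₂`. -/
def spokeExt (x : Fin 14 → ℝ) : TrefEL ⊕ TrefEO → ℝ
  | .inr (.AO i) => ![x 2, x 6, x 10] i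
  | .inr (.AO' i) => ![0, x 9, x 12] i
  | .inr (.AP i) => ![0, x 7, x 11] i
  | .inr (.BO i) => ![0, x 0, x 4] i
  | .inr (.BP i) => ![x 3, x 8, x 5] i
  | .inr (.BP' i) => ![0, x 1, x 13] i
  | _ => 0

theorem tetRate_chordExt_axis (h1 : Real.cos φ ≠ 0) (h2 : Real.cos (2 * φ) ≠ 0)
    (y : Fin 4 → ℝ) (t : TrefT) :
    tetRate φ (chordExt y) t 0 = chordExt y (tetEdge t 2 3) /
      ((height (axisEnds t).2 - height (axisEnds t).1) * Real.cos (turn φ t)) := by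
  rw [tetRate, tetEdge_eq_edgeTable,
    ← cornerRate_axis (height_axisEnds_ne t) (turn_cos_ne h1 h2 t) (Real.sin (turn φ t))]
  cases t <;> rfl

theorem starSum_tetRate_AB (h1 : Real.cos φ ≠ 0) (h2 : Real.cos (2 * φ) ≠ 0) (y : Fin 4 → ℝ) :
    starSum (tetRate φ (chordExt y)) (.inr (.AB i)) =
      ((![y 0, y 1, y 2] i + ![y 0, y 1, y 2] (i + 1)) / Real.cos φ - y 3 / Real.cos (2 * φ)) /
        (height (.A i) - height (.B i)) := by
  have hh := sub_ne_zero.2 (height_ne i i)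
  rw [starSum_AB]
  simp only [tetRate_chordExt_axis h1 h2]
  simp only [axisEnds, turn, tetEdge, edgeTable, Fin.isValue, Matrix.cons_val, chordExt,
    add_sub_cancel_right]
  rw [← neg_sub (height (.A i)) (height (.B i))]
  field_simp
  ring

theorem starSum_tetRate_toB (h1 : Real.cos φ ≠ 0) (h2 : Real.cos (2 * φ) ≠ 0) (y : Fin 4 → ℝ) :
    starSum (tetRate φ (chordExt y)) (.inl (.toB i)) =
      (y 3 / Real.cos (2 * φ) - ![y 0, y 1, y 2] i / Real.cos φ) /
        (height (.A (i - 1)) - height (.B i)) := by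
  have hh := sub_ne_zero.2 (height_ne (i - 1) i)
  rw [starSum_toB]
  simp only [tetRate_chordExt_axis h1 h2]
  simp only [axisEnds, turn, tetEdge, edgeTable, Fin.isValue, Matrix.cons_val, chordExt]
  rw [← neg_sub (height (.A (i - 1))) (height (.B i))]
  field_simp
  ring

/-- With the axis edges held fixed, the terms other than `spokeRate` depend on the spokes only
through the two differences `u` (spokes to `O`) and `v` (spokes to `P`). They form the gradient of a
quadratic form proportional to `σu² - 2uv + σv²`. -/
theorem tetRate_spoke (h1 : Real.cos φ ≠ 0) (h2 : Real.cos (2 * φ) ≠ 0)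
    (h01 : ∀ t, δ (tetEdge t 0 1) = 0) (t : TrefT) :
    tetRate φ δ t 1 = (Real.sin (turn φ t) * (δ (tetEdge t 0 2) - δ (tetEdge t 1 2)) -
        (δ (tetEdge t 0 3) - δ (tetEdge t 1 3))) /
        ((height (axisEnds t).2 - height (axisEnds t).1) * Real.cos (turn φ t)) +
      spokeRate (height (axisEnds t).1) (Real.cos (turn φ t)) (Real.sin (turn φ t))
        (δ (tetEdge t 0 2)) (δ (tetEdge t 0 3)) (δ (tetEdge t 2 3)) ∧
    tetRate φ δ t 2 = (Real.sin (turn φ t) * (δ (tetEdge t 0 3) - δ (tetEdge t 1 3)) -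
        (δ (tetEdge t 0 2) - δ (tetEdge t 1 2))) /
        ((height (axisEnds t).2 - height (axisEnds t).1) * Real.cos (turn φ t)) +
      spokeRate (height (axisEnds t).1) (Real.cos (turn φ t)) (Real.sin (turn φ t))
        (δ (tetEdge t 0 3)) (δ (tetEdge t 0 2)) (δ (tetEdge t 2 3)) ∧
    tetRate φ δ t 3 = (Real.sin (turn φ t) * (δ (tetEdge t 1 2) - δ (tetEdge t 0 2)) -
        (δ (tetEdge t 1 3) - δ (tetEdge t 0 3))) /
        ((height (axisEnds t).2 - height (axisEnds t).1) * Real.cos (turn φ t)) -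
      spokeRate (height (axisEnds t).2) (Real.cos (turn φ t)) (Real.sin (turn φ t))
        (δ (tetEdge t 1 2)) (δ (tetEdge t 1 3)) (δ (tetEdge t 2 3)) ∧
    tetRate φ δ t 4 = (Real.sin (turn φ t) * (δ (tetEdge t 1 3) - δ (tetEdge t 0 3)) -
        (δ (tetEdge t 1 2) - δ (tetEdge t 0 2))) /
        ((height (axisEnds t).2 - height (axisEnds t).1) * Real.cos (turn φ t)) -
      spokeRate (height (axisEnds t).2) (Real.cos (turn φ t)) (Real.sin (turn φ t))
        (δ (tetEdge t 1 3)) (δ (tetEdge t 1 2)) (δ (tetEdge t 2 3)) := by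
  have hab := height_axisEnds_ne t
  have hγ := turn_cos_ne h1 h2 t
  have hu := Real.cos_sq_add_sin_sq (turn φ t)
  simp only [tetRate, tetEdge_eq_edgeTable, cornerRate_spoke1 hab hγ hu,
    cornerRate_spoke2 hab hγ hu, cornerRate_spoke3 hab hγ hu, cornerRate_spoke4 hab hγ hu, h01,
    mul_zero, sub_zero, add_zero, and_self]

end

end Trefoil
end

noncomputable section
namespace Trefoil

/-! ### The determinant of the spoke block -/

open Matrix

/-- The linear forms in the spoke variables that diagonalize most of the spoke block. -/
def mainForms (c s : ℝ) : Matrix (Fin 14) (Fin 14) ℝ :=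
  !![-1, 0, 0, 0, 0, 0, 0, 0, 0, 0, 0, 0, 0, 0;
    0, -1, 0, 0, 0, 0, 0, 0, 0, 0, 0, 0, 0, 0;
    0, 0, 1, 0, 0, 0, 0, 0, 0, 0, 0, 0, 0, 0;
    0, 0, 0, 1, 0, 0, 0, 0, 0, 0, 0, 0, 0, 0;
    0, 0, 1, 0, -1, 0, 0, 0, 0, 0, 0, 0, 0, 0;
    0, 0, 0, 0, 0, -1, 0, 0, 0, 0, 0, 0, 0, 0;
    0, 0, 0, 0, 0, 0, 1, 0, 0, 0, 0, 0, 0, 0;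
    0, 0, 0, -1, 0, 0, 0, 1, 0, 0, 0, 0, 0, 0;
    -s, 1, 0, 0, 0, 0, s, c - 1, -c, 0, 0, 0, 0, 0;
    1 - c, 0, 0, 0, 0, 0, c, s, -s, -1, 0, 0, 0, 0;
    -1, 0, 0, 0, 0, 0, 0, 0, 0, 0, 1, 0, 0, 0;
    0, 0, 0, 0, 0, 0, 0, 0, -1, 0, 0, 1, 0, 0;
    0, 0, 0, 0, 1 - c, -s, 0, 0, 0, 0, c, s, -1, 0;
    0, 0, 0, 0, -s, -c, 0, 0, 0, 0, s, c - 1, 0, 1]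

/-- The remaining linear forms. -/
def extraForms : Matrix (Fin 4) (Fin 14) ℝ :=
  !![0, 0, 0, 0, -1, 0, 0, 0, 0, 1, 0, 0, 0, 0;
    0, 0, 0, 0, 0, 0, 0, 1, 0, 0, 0, 0, 0, -1;
    0, 0, 0, 0, 0, 0, 0, 0, 0, 0, 0, 0, 1, 0;
    0, 0, 0, 0, 0, 0, 0, 0, 0, 0, 0, 1, 0, 0]

/-- The expression of the remaining forms through the main ones. -/
def extraCoeffs (c s : ℝ) : Matrix (Fin 4) (Fin 14) ℝ :=
  !![(2 * c ^ 2 - 1) / c - 1, s / c, -1, s / c, 1, 0, (2 * c ^ 2 - 1) / c, s / c, s / c, -1,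
      0, 0, 0, 0;
    -s / c, (1 - c) / c, -s, 1 + (c - 1) ^ 2 / c, s, c, (c - 1) * s / c, 1 + (c - 1) ^ 2 / c,
      (1 - c) / c, 0, s, c - 1, 0, -1;
    -(2 * c ^ 2 - 1) / c, -s / c, 1 - c, s * (c - 1) / c, -(1 - c), s, s ^ 2 / c,
      s * (c - 1) / c, -s / c, 0, c, s, -1, 0;
    s / c, -1 / c, 0, (c - 1) / c, 0, 0, s / c, (c - 1) / c, -1 / c, 0, 0, 1, 0, 0]

/-- A symmetric `2 × 2` matrix with constant diagonal. -/
def symPair (k x y : ℝ) : Matrix (Fin 2) (Fin 2) ℝ := !![k * x, k * y; k * y, k * x]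

/-- `Fin 14` as a sum of seven pairs. -/
def pairIndex : Fin 14 ≃ Fin 2 × Fin 7 :=
  (finProdFinEquiv (m := 7) (n := 2)).symm.trans (Equiv.prodComm _ _)

/-- The weights of the main forms. -/
def mainWeightBlocks (c s : ℝ) : Fin 7 → Matrix (Fin 2) (Fin 2) ℝ :=
  ![symPair (1 / (2 * c * (2 * c ^ 2 - 1))) (-s) (-((2 * c ^ 2 - 1) - c)),
    symPair (1 / (3 * c)) (-s) c,
    symPair (1 / c) s (-(1 - c)),
    symPair (1 / (4 * c)) s (-(1 - c)),
    symPair (1 / (3 * c * (2 * c ^ 2 - 1))) s (-c),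
    symPair (1 / (4 * c)) s (-(1 - c)),
    symPair (1 / (3 * c * (2 * c ^ 2 - 1))) s (-c)]

/-- The inverses of `mainWeightBlocks`. -/
def mainWeightInvBlocks (c s : ℝ) : Fin 7 → Matrix (Fin 2) (Fin 2) ℝ :=
  ![symPair (1 / (1 - c)) (-s) ((2 * c ^ 2 - 1) - c),
    symPair (3 * c / (2 * c ^ 2 - 1)) s c,
    symPair (1 / (2 * (1 - c))) s (1 - c),
    symPair (2 / (1 - c)) s (1 - c),
    symPair (-3 * c) s c,
    symPair (2 / (1 - c)) s (1 - c),
    symPair (-3 * c) s c]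

/-- The weight matrix of the main forms. -/
def mainWeight (c s : ℝ) : Matrix (Fin 14) (Fin 14) ℝ :=
  (blockDiagonal (mainWeightBlocks c s)).submatrix pairIndex pairIndex

/-- The inverse of `mainWeight`. -/
def mainWeightInv (c s : ℝ) : Matrix (Fin 14) (Fin 14) ℝ :=
  (blockDiagonal (mainWeightInvBlocks c s)).submatrix pairIndex pairIndex

/-- The weight matrix of the remaining forms. -/
def extraWeight (c s : ℝ) : Matrix (Fin 4) (Fin 4) ℝ :=
  let k := 1 / (2 * c * (2 * c ^ 2 - 1))
  let l := 1 / (5 * c * (2 * c ^ 2 - 1))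
  let e := -((2 * c ^ 2 - 1) - c)
  !![k * -s, k * e, 0, 0; k * e, k * -s, 0, 0; 0, 0, l * -s, l * e; 0, 0, l * e, l * -s]

/-- The inverse of `extraWeight`. -/
def extraWeightInv (c s : ℝ) : Matrix (Fin 4) (Fin 4) ℝ :=
  let k := 1 / (1 - c)
  let l := 5 / (2 * (1 - c))
  let e := (2 * c ^ 2 - 1) - c
  !![k * -s, k * e, 0, 0; k * e, k * -s, 0, 0; 0, 0, l * -s, l * e; 0, 0, l * e, l * -s]

/-- The matrix to which the determinant of the spoke block is reduced. -/
def coreMatrix (c s : ℝ) : Matrix (Fin 4) (Fin 4) ℝ :=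
  let u := 1 - 2 * c
  let v := 1 - c
  let d := 2 * c ^ 2 - 1
  !![3 / 2 * s * u, 3 / 2 * u * v, -3 * s * v, -3 * v;
    3 / 2 * u * v, -(3 / 2) * s * u ^ 2 / d, -3 * v ^ 2, 3 * s * v ^ 2 / d;
    -3 * s * v, -3 * v ^ 2, 3 / 2 * s * (3 - 2 * c), 9 / 2 * v;
    -3 * v, 3 * s * v ^ 2 / d, 9 / 2 * v, -(3 / 2) * s * (3 - 4 * c) / d]

variable {c s : ℝ}

/-- The spokes are ordered so that each successive pair of forms introduces two new variables; the
matrix is triangular. -/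
theorem det_mainForms (c s : ℝ) : (mainForms c s).det = -c := by
  rw [det_of_isLowerTriangular]
  · simp [mainForms, Fin.prod_univ_succ]
  · intro i j hij
    rw [OrderDual.toDual_lt_toDual] at hij
    fin_cases i <;> fin_cases j <;> first | rfl | exact absurd hij (by decide)

theorem extraCoeffs_mul_mainForms (hc : c ≠ 0) (hcs : s ^ 2 = 1 - c ^ 2) :
    extraCoeffs c s * mainForms c s = extraForms := by
  ext i j
  fin_cases i <;> fin_cases j <;>
    simp [extraCoeffs, mainForms, extraForms, Matrix.mul_apply, Fin.sum_univ_succ] <;> grind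

theorem det_coreMatrix (hd : 2 * c ^ 2 - 1 ≠ 0) (hcs : s ^ 2 = 1 - c ^ 2) :
    (coreMatrix c s).det = 81 / 4 * c ^ 4 * (1 - c) ^ 2 := by
  have h4 : s ^ 4 = (1 - c ^ 2) ^ 2 := by rw [← hcs]; ring
  simp only [coreMatrix]
  generalize hdd : 2 * c ^ 2 - 1 = d at *
  simp [Matrix.det_succ_row_zero, Fin.sum_univ_succ, Fin.succAbove]
  field_simp
  subst hdd
  ring_nf
  simp only [h4, hcs]
  ring
theorem mainWeight_mul_inv (hc : c ≠ 0) (hc1 : 1 - c ≠ 0) (hd : 2 * c ^ 2 - 1 ≠ 0)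
    (hcs : s ^ 2 = 1 - c ^ 2) : mainWeight c s * mainWeightInv c s = 1 := by
  rw [mainWeight, mainWeightInv, submatrix_mul_equiv, ← blockDiagonal_mul]
  have h : (fun k => mainWeightBlocks c s k * mainWeightInvBlocks c s k) = 1 := by
    funext k
    fin_cases k <;> ext i j <;> fin_cases i <;> fin_cases j <;>
      simp [mainWeightBlocks, mainWeightInvBlocks, symPair, Matrix.mul_apply] <;>
      field_simp <;> grind
  rw [h, blockDiagonal_one, submatrix_one_equiv]

theorem extraWeight_mul_inv (hc : c ≠ 0) (hc1 : 1 - c ≠ 0) (hd : 2 * c ^ 2 - 1 ≠ 0)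
    (hcs : s ^ 2 = 1 - c ^ 2) : extraWeight c s * extraWeightInv c s = 1 := by
  ext i j
  fin_cases i <;> fin_cases j <;>
    simp [extraWeight, extraWeightInv, Matrix.mul_apply, Fin.sum_univ_succ] <;>
    field_simp <;> grind

theorem det_mainWeight (hc : c ≠ 0) (hd : 2 * c ^ 2 - 1 ≠ 0) (hcs : s ^ 2 = 1 - c ^ 2) :
    (mainWeight c s).det = -((1 - c) ^ 4 /
      (46656 * c ^ 10 * (2 * c ^ 2 - 1) ^ 2)) := by
  rw [mainWeight, det_submatrix_equiv_self, det_blockDiagonal]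
  have h : ∀ k x y : ℝ, (symPair k x y).det = k ^ 2 * (x ^ 2 - y ^ 2) := by
    intro k x y; simp [symPair, det_fin_two]; ring
  have e1 : (-s) ^ 2 - (-((2 * c ^ 2 - 1) - c)) ^ 2 = 2 * (1 - c) * c * (2 * c ^ 2 - 1) := by
    rw [neg_sq, hcs]; ring
  have e2 : (-s) ^ 2 - c ^ 2 = -(2 * c ^ 2 - 1) := by rw [neg_sq, hcs]; ring
  have e3 : s ^ 2 - (-(1 - c)) ^ 2 = 2 * c * (1 - c) := by rw [hcs]; ring
  have e4 : s ^ 2 - (-c) ^ 2 = -(2 * c ^ 2 - 1) := by rw [hcs]; ring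
  simp [Fin.prod_univ_succ, mainWeightBlocks, h, -neg_mul, -neg_sub, -even_two, -Even.neg_pow,
    e1, e2, e3, e4]
  field_simp
  ring

theorem det_extraWeight (hc : c ≠ 0) (hd : 2 * c ^ 2 - 1 ≠ 0) (hcs : s ^ 2 = 1 - c ^ 2) :
    (extraWeight c s).det = (1 - c) ^ 2 / (25 * c ^ 2 * (2 * c ^ 2 - 1) ^ 2) := by
  have h4 : s ^ 4 = (1 - c ^ 2) ^ 2 := by rw [← hcs]; ring
  simp [extraWeight, Matrix.det_succ_row_zero, Fin.sum_univ_succ, Fin.succAbove]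
  generalize hdd : 2 * c ^ 2 - 1 = d at *
  field_simp
  subst hdd
  ring_nf
  simp only [h4, hcs]
  ring

end Trefoil
end

/-! ### Reduction of the spoke determinant to size four. -/

noncomputable section
namespace Trefoil
open Matrix
variable {c s : ℝ}

theorem blockDiagonal_pairIndex_mulVec (w : Fin 7 → Matrix (Fin 2) (Fin 2) ℝ)
    (y : Fin 14 → ℝ) :
    (blockDiagonal w).submatrix pairIndex pairIndex *ᵥ y =
      ![w 0 0 0 * y 0 + w 0 0 1 * y 1, w 0 1 0 * y 0 + w 0 1 1 * y 1,
        w 1 0 0 * y 2 + w 1 0 1 * y 3, w 1 1 0 * y 2 + w 1 1 1 * y 3,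
        w 2 0 0 * y 4 + w 2 0 1 * y 5, w 2 1 0 * y 4 + w 2 1 1 * y 5,
        w 3 0 0 * y 6 + w 3 0 1 * y 7, w 3 1 0 * y 6 + w 3 1 1 * y 7,
        w 4 0 0 * y 8 + w 4 0 1 * y 9, w 4 1 0 * y 8 + w 4 1 1 * y 9,
        w 5 0 0 * y 10 + w 5 0 1 * y 11, w 5 1 0 * y 10 + w 5 1 1 * y 11,
        w 6 0 0 * y 12 + w 6 0 1 * y 13, w 6 1 0 * y 12 + w 6 1 1 * y 13] := by
  funext i
  obtain ⟨⟨p, k⟩, rfl⟩ := pairIndex.symm.surjective i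
  have h : ((blockDiagonal w).submatrix pairIndex pairIndex *ᵥ y) (pairIndex.symm (p, k)) =
      w k p 0 * y (pairIndex.symm (0, k)) + w k p 1 * y (pairIndex.symm (1, k)) := by
    rw [mulVec, dotProduct, ← Equiv.sum_comp pairIndex.symm, Fintype.sum_prod_type]
    simp [blockDiagonal_apply]
  rw [h]
  fin_cases p <;> fin_cases k <;> rfl

/-- The scalar is common to all sixteen entries, and the determinant of `coreMatrix` no longer
contains `1 - 2c`. This is where the Alexander polynomial enters, to the fourth power because the
size is four. -/
theorem core_eq (hc : c ≠ 0) (hc1 : 1 - c ≠ 0) (hd : 2 * c ^ 2 - 1 ≠ 0)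
    (hcs : s ^ 2 = 1 - c ^ 2) :
    extraWeightInv c s + extraCoeffs c s * mainWeightInv c s * (extraCoeffs c s)ᵀ =
      ((1 - 2 * c) / (1 - c)) • coreMatrix c s := by
  have h3 : s ^ 3 = s * (1 - c ^ 2) := by rw [← hcs]; ring
  have h4 : s ^ 4 = (1 - c ^ 2) ^ 2 := by rw [← hcs]; ring
  have h5 : s ^ 5 = s * (1 - c ^ 2) ^ 2 := by rw [← hcs]; ring
  have key : ∀ i j, (extraCoeffs c s * mainWeightInv c s * (extraCoeffs c s)ᵀ) i j =
      extraCoeffs c s i ⬝ᵥ (mainWeightInv c s *ᵥ extraCoeffs c s j) := by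
    intro i j
    rw [Matrix.mul_assoc]
    rfl
  ext i j
  rw [Matrix.add_apply, key, mainWeightInv, blockDiagonal_pairIndex_mulVec]
  fin_cases i <;> fin_cases j <;>
    simp [extraWeightInv, extraCoeffs, coreMatrix, mainWeightInvBlocks, symPair, dotProduct,
      Fin.sum_univ_succ] <;>
    generalize hdd : 2 * c ^ 2 - 1 = d at * <;>
    field_simp <;> subst hdd <;> ring_nf <;> simp only [h3, h4, h5, hcs] <;> ring

/-- With main forms `M`, extra forms `XM` and weights `W`, `V`, the matrix is `Mᵀ (W + Xᵀ V X) M`.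
The matrix determinant lemma turns its determinant into `det M² · det W · det V · det (V⁻¹ + X W⁻¹
Xᵀ)`. -/
theorem det_spoke (hc : c ≠ 0) (hc1 : 1 - c ≠ 0) (hd : 2 * c ^ 2 - 1 ≠ 0)
    (hcs : s ^ 2 = 1 - c ^ 2) :
    ((mainForms c s)ᵀ * mainWeight c s * mainForms c s +
      extraFormsᵀ * extraWeight c s * extraForms).det =
      -((1 - c) ^ 4 * (1 - 2 * c) ^ 4 / (57600 * c ^ 6 * (2 * c ^ 2 - 1) ^ 4)) := by
  have hW := mainWeight_mul_inv hc hc1 hd hcs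
  have hV := extraWeight_mul_inv hc hc1 hd hcs
  have h : (mainForms c s)ᵀ * mainWeight c s * mainForms c s +
      extraFormsᵀ * extraWeight c s * extraForms = (mainForms c s)ᵀ * (mainWeight c s *
        (1 + (mainWeightInv c s * (extraCoeffs c s)ᵀ) * (extraWeight c s * extraCoeffs c s))) *
        mainForms c s := by
    rw [← extraCoeffs_mul_mainForms hc hcs, Matrix.mul_add, Matrix.mul_one,
      ← Matrix.mul_assoc (mainWeight c s), ← Matrix.mul_assoc (mainWeight c s), hW,
      Matrix.one_mul, Matrix.mul_add, Matrix.add_mul, Matrix.transpose_mul]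
    simp only [Matrix.mul_assoc]
  have h2 : 1 + extraWeight c s * extraCoeffs c s *
      (mainWeightInv c s * (extraCoeffs c s)ᵀ) =
      extraWeight c s * (((1 - 2 * c) / (1 - c)) • coreMatrix c s) := by
    rw [← core_eq hc hc1 hd hcs, Matrix.mul_add, hV]
    simp only [Matrix.mul_assoc]
  rw [h, det_mul, det_mul, det_transpose, det_mul, det_one_add_mul_comm, h2, det_mul, det_smul,
    det_mainForms, det_mainWeight hc hd hcs, det_extraWeight hc hd hcs, det_coreMatrix hd hcs]
  simp only [Fintype.card_fin]
  field_simp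
  ring

end Trefoil
end

/-! ### The spoke block as a sum of quadratic forms. -/

noncomputable section
namespace Trefoil
open Matrix FundamentalFamily

/-- The edges from the axis to the circle which are not in `𝓑₂`. -/
def spokeEdge : Fin 14 → TrefEL ⊕ TrefEO :=
  ![.inr (.BO 1), .inr (.BP' 1), .inr (.AO 0), .inr (.BP 0), .inr (.BO 2), .inr (.BP 2),
    .inr (.AO 1), .inr (.AP 1), .inr (.BP 1), .inr (.AO' 1), .inr (.AO 2), .inr (.AP 2),
    .inr (.AO' 2), .inr (.BP' 2)]

theorem mainForms_mulVec (c s : ℝ) (x : Fin 14 → ℝ) : mainForms c s *ᵥ x =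
    ![-x 0, -x 1, x 2, x 3, x 2 - x 4, -x 5, x 6, x 7 - x 3,
      -s * x 0 + x 1 + s * x 6 + (c - 1) * x 7 - c * x 8,
      (1 - c) * x 0 + c * x 6 + s * x 7 - s * x 8 - x 9,
      x 10 - x 0, x 11 - x 8,
      (1 - c) * x 4 - s * x 5 + c * x 10 + s * x 11 - x 12,
      -s * x 4 - c * x 5 + s * x 10 + (c - 1) * x 11 + x 13] := by
  funext i
  fin_cases i <;> simp [mainForms, Matrix.mulVec, dotProduct, Fin.sum_univ_succ] <;> ring

theorem mainForms_transpose_mulVec (c s : ℝ) (y : Fin 14 → ℝ) : (mainForms c s)ᵀ *ᵥ y =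
    ![-y 0 - s * y 8 + (1 - c) * y 9 - y 10, -y 1 + y 8, y 2 + y 4, y 3 - y 7,
      -y 4 + (1 - c) * y 12 - s * y 13, -y 5 - s * y 12 - c * y 13,
      y 6 + s * y 8 + c * y 9, y 7 + (c - 1) * y 8 + s * y 9, -c * y 8 - s * y 9 - y 11,
      -y 9, y 10 + c * y 12 + s * y 13, y 11 + s * y 12 + (c - 1) * y 13, -y 12, y 13] := by
  funext i
  fin_cases i <;> simp [mainForms, Matrix.mulVec, dotProduct, Fin.sum_univ_succ] <;> ring

theorem tetEdge_axis_spokeExt (x : Fin 14 → ℝ) (t : TrefT) :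
    spokeExt x (tetEdge t 0 1) = 0 := by
  cases t <;> rfl

theorem extraForms_mulVec (x : Fin 14 → ℝ) : extraForms *ᵥ x =
    ![x 9 - x 4, x 7 - x 13, x 12, x 11] := by
  funext i
  fin_cases i <;> simp [extraForms, Matrix.mulVec, dotProduct, Fin.sum_univ_succ] <;> ring

theorem extraForms_transpose_mulVec (y : Fin 4 → ℝ) : extraFormsᵀ *ᵥ y =
    ![0, 0, 0, 0, -y 0, 0, 0, y 1, 0, y 0, 0, y 3, y 2, -y 1] := by
  funext i
  fin_cases i <;> simp [extraForms, Matrix.mulVec, dotProduct, Fin.sum_univ_succ]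

/-- Once the face terms cancel, a tetrahedron contributes the form `-(σu² - 2uv + σv²) / ((b -
a)γ)`, with `u`, `v` the differences of its spokes to the vertex over `O` and to `P`. The two
tetrahedra at a link edge have the same `u`, `v` up to a common sign. The four at `A_i B_i` add up
to a form of rank at most two. The pairs of rows of `mainForms` belong, in order, to `toB 1`, `AB
0`, `toA 0`, `toA 1`, `AB 1`, `toA 2`, `AB 2`; those of `extraForms` to `toB 2` and `toB 0`. The
denominators 1 to 5 in the weights come from the differences of heights. -/
theorem starSum_tetRate_spokeExt {φ : ℝ} (h1 : Real.cos φ ≠ 0) (h2 : Real.cos (2 * φ) ≠ 0)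
    (x : Fin 14 → ℝ) (k : Fin 14) :
    -starSum (tetRate φ (spokeExt x)) (spokeEdge k) =
      (((mainForms (Real.cos φ) (Real.sin φ))ᵀ * mainWeight (Real.cos φ) (Real.sin φ) *
        mainForms (Real.cos φ) (Real.sin φ) + extraFormsᵀ *
        extraWeight (Real.cos φ) (Real.sin φ) * extraForms) *ᵥ x) k := by
  have h t := tetRate_spoke (spokeExt x) h1 h2 (tetEdge_axis_spokeExt x) t
  have hcs : Real.sin φ ^ 2 = 1 - Real.cos φ ^ 2 := Real.sin_sq φ
  rw [Matrix.add_mulVec, ← mulVec_mulVec, ← mulVec_mulVec, ← mulVec_mulVec, ← mulVec_mulVec,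
    mainForms_mulVec, extraForms_mulVec, mainWeight, blockDiagonal_pairIndex_mulVec,
    mainForms_transpose_mulVec, extraForms_transpose_mulVec]
  rw [Real.cos_two_mul] at h2
  generalize hc : Real.cos φ = c at *
  generalize hs : Real.sin φ = s at *
  have e1 : (-1 : Fin 3) = 2 := rfl
  have e2 : (2 : Fin 3) + 1 = 0 := rfl
  have e3 : (1 : Fin 3) + 1 = 2 := rfl
  have e4 : (1 : Fin 3) - 1 = 0 := rfl
  have e5 : (2 : Fin 3) - 1 = 1 := rfl
  have e6 : (0 : Fin 3) - 1 = 2 := rfl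
  have hs3 : s ^ 3 = s * (1 - c ^ 2) := by rw [← hcs]; ring
  fin_cases k <;>
    simp only [spokeEdge, Fin.zero_eta, Fin.mk_one, Fin.reduceFinMk, Fin.isValue,
      Matrix.cons_val, Matrix.cons_val_zero, Matrix.cons_val_one,
      starSum_AO, starSum_AO', starSum_AP, starSum_BO, starSum_BP, starSum_BP', h] <;>
    simp only [axisEnds, turn, tetEdge, edgeTable, spokeExt, height, e2, e3, e4, e5, e6,
      Matrix.cons_val, Matrix.cons_val_zero, Matrix.cons_val_one, Fin.isValue, zero_add,
      Real.cos_zero, Real.sin_zero, Real.cos_two_mul, Real.sin_two_mul, hc, hs, Pi.add_apply,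
      mainWeightBlocks, symPair, extraWeight, Matrix.of_apply, Matrix.mulVec, dotProduct,
      Fin.sum_univ_four, Fin.coe_ofNat_eq_mod, Nat.zero_mod, Nat.one_mod, Nat.reduceMod,
      Nat.cast_zero, Nat.cast_one, Nat.cast_ofNat] <;>
    norm_num <;>
    generalize hdd : 2 * c ^ 2 - 1 = d at * <;>
    field_simp <;> subst hdd <;> ring_nf <;> simp only [hs3, hcs] <;> ring

end Trefoil
end

noncomputable section
namespace Trefoil
open Matrix FundamentalFamily

/-! ### The minor of `f₃` -/

/-- The edges `(gO)P` which are not in `𝓑₂`. -/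
def chordEdge : Fin 4 → TrefEL ⊕ TrefEO :=
  ![.inr (.OPmid 0), .inr (.OPmid 1), .inr (.OPmid 2), .inr .OPhigh]

/-- The edges on the axis which are not in `𝓑₂`. -/
def axisEdge : Fin 4 → TrefEL ⊕ TrefEO :=
  ![.inr (.AB 0), .inr (.AB 1), .inr (.AB 2), .inl (.toB 2)]

/-- The edges in `𝓑₃`. -/
def restEdge : Fin 4 ⊕ (Fin 4 ⊕ Fin 14) → TrefEL ⊕ TrefEO :=
  Sum.elim chordEdge (Sum.elim axisEdge spokeEdge)

theorem restEdge_injective : Function.Injective restEdge := by decide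

theorem restEdge_notMem : ∀ i, restEdge i ∉ Set.range choice.b2 := by
  simp only [Set.mem_range]
  decide

theorem exists_restEdge : ∀ e, e ∉ Set.range choice.b2 → ∃ i, restEdge i = e := by
  simp only [Set.mem_range]
  decide

/-- The enumeration of `𝓑₃` by `restEdge`. -/
def restEquiv : Fin 4 ⊕ (Fin 4 ⊕ Fin 14) ≃ {e // e ∉ Set.range choice.b2} :=
  Equiv.ofBijective (fun i => ⟨restEdge i, restEdge_notMem i⟩)
    ⟨fun _ _ h => restEdge_injective (congrArg Subtype.val h),
      fun e => (exists_restEdge e.1 e.2).imp fun _ h => Subtype.ext h⟩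

theorem minor3_eq (f3 : Matrix (TrefEL ⊕ TrefEO) (TrefEL ⊕ TrefEO) ℝ) :
    choice.minor3 f3 = (f3.submatrix restEdge restEdge).det := by
  classical
  have h := det_submatrix_equiv_self restEquiv
    (f3.submatrix (fun e : {e // e ∉ Set.range choice.b2} => e.1) fun e => e.1)
  rw [submatrix_submatrix] at h
  rw [MinorChoice.minor3]
  convert h.symm <;> rfl

/-- The exchange of the first two blocks of indices. -/
def swapBlocks : Equiv.Perm (Fin 4 ⊕ (Fin 4 ⊕ Fin 14)) :=
  ((Equiv.sumAssoc (Fin 4) (Fin 4) (Fin 14)).symm.trans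
    (Equiv.Perm.sumCongr (Equiv.sumComm (Fin 4) (Fin 4)) 1)).trans (Equiv.sumAssoc _ _ _)

/-- Exchanging two adjacent blocks of four indices takes sixteen transpositions. -/
theorem sign_swapBlocks : Equiv.Perm.sign swapBlocks = 1 := by
  rw [swapBlocks, Equiv.Perm.sign_symm_trans_trans, Equiv.Perm.sign_sumCongr, map_one, mul_one]
  decide

/-- After the first two column blocks are exchanged the matrix is block lower triangular, and its
lower right corner is block upper triangular. The remaining blocks, such as axis edges against
spokes, do not affect the determinant and need not be computed. -/
theorem det_of_zero_blocks (M : Matrix (Fin 4 ⊕ (Fin 4 ⊕ Fin 14)) (Fin 4 ⊕ (Fin 4 ⊕ Fin 14)) ℝ)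
    (h00 : ∀ i j, M (.inl i) (.inl j) = 0) (h02 : ∀ i j, M (.inl i) (.inr (.inr j)) = 0)
    (h20 : ∀ i j, M (.inr (.inr i)) (.inl j) = 0) :
    M.det = (of fun i j => M (.inl i) (.inr (.inl j))).det *
      ((of fun i j => M (.inr (.inl i)) (.inl j)).det *
        (of fun i j => M (.inr (.inr i)) (.inr (.inr j))).det) := by
  have h : M.submatrix id swapBlocks =
      fromBlocks (of fun i j => M (.inl i) (.inr (.inl j))) 0
        (of fun i j => M (.inr i) (.inr (.inl j)))
        (fromBlocks (of fun i j => M (.inr (.inl i)) (.inl j))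
          (of fun i j => M (.inr (.inl i)) (.inr (.inr j))) 0
          (of fun i j => M (.inr (.inr i)) (.inr (.inr j)))) := by
    ext i j
    rcases i with i | i | i <;> rcases j with j | j | j <;>
      first | rfl | exact h00 _ _ | exact h02 _ _ | exact h20 _ _
  have h2 := det_permute' swapBlocks M
  rw [sign_swapBlocks, h, det_fromBlocks_zero₁₂, det_fromBlocks_zero₂₁] at h2
  simpa using h2.symm

theorem single_chordEdge (j : Fin 4) :
    (fun e => if e = chordEdge j then (1 : ℝ) else 0) = chordExt (Pi.single j 1) := by
  funext e
  rcases e with (i | i) | (i | i | i | i | i | i | i | _ | i | _) <;> fin_cases j <;>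
    first
      | simp [chordEdge, chordExt]; done
      | fin_cases i <;> simp [chordEdge, chordExt]

theorem single_axisEdge (j : Fin 4) :
    (fun e => if e = axisEdge j then (1 : ℝ) else 0) = axisExt (Pi.single j 1) := by
  funext e
  rcases e with (i | i) | (i | i | i | i | i | i | i | _ | i | _) <;> fin_cases j <;>
    first
      | simp [axisEdge, axisExt]; done
      | fin_cases i <;> simp [axisEdge, axisExt]

theorem single_spokeEdge (j : Fin 14) :
    (fun e => if e = spokeEdge j then (1 : ℝ) else 0) = spokeExt (Pi.single j 1) := by
  funext e
  rcases e with (i | i) | (i | i | i | i | i | i | i | _ | i | _) <;> fin_cases j <;>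
    first
      | simp [spokeEdge, spokeExt]; done
      | fin_cases i <;> simp [spokeEdge, spokeExt]

section
variable {φ : ℝ}

theorem starSum_tetRate_chord_eq_zero (h1 : Real.cos φ ≠ 0) (h2 : Real.cos (2 * φ) ≠ 0)
    (δ : TrefEL ⊕ TrefEO → ℝ) (hl : ∀ e, δ (.inl e) = 0) (hX : ∀ i, δ (.inr (.AB i)) = 0)
    (k : Fin 4) : starSum (tetRate φ δ) (chordEdge k) = 0 := by
  fin_cases k <;>
    simp [chordEdge, starSum_tetRate_OPmid δ _ h1 h2, starSum_tetRate_OPhigh δ h1 h2, hl, hX]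

theorem starSum_tetRate_spoke_chordExt (h1 : Real.cos φ ≠ 0) (h2 : Real.cos (2 * φ) ≠ 0)
    (y : Fin 4 → ℝ) (k : Fin 14) : starSum (tetRate φ (chordExt y)) (spokeEdge k) = 0 := by
  have h t := tetRate_spoke (chordExt y) h1 h2 (fun t => by cases t <;> rfl) t
  have e1 : (-1 : Fin 3) = 2 := rfl
  fin_cases k <;>
    simp [spokeEdge, starSum_AO, starSum_AO', starSum_AP, starSum_BO, starSum_BP, starSum_BP', h,
      axisEnds, turn, tetEdge, edgeTable, chordExt, e1]

/-- The block of `f₃` with rows `chordEdge` and columns `axisEdge`, up to sign. -/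
def chordAxis (c d : ℝ) : Matrix (Fin 4) (Fin 4) ℝ :=
  !![1 / (3 * c), 0, 1 / (3 * c), 0;
    1 / (3 * c), 1 / (3 * c), 0, 0;
    0, 1 / (3 * c), 1 / (3 * c), -1 / (2 * c);
    -1 / (3 * d), -1 / (3 * d), -1 / (3 * d), 1 / (2 * d)]

theorem det_chordAxis {c d : ℝ} (hc : c ≠ 0) (hd : d ≠ 0) :
    (chordAxis c d).det = 1 / (54 * c ^ 3 * d) := by
  simp [chordAxis, Matrix.det_succ_row_zero, Fin.sum_univ_succ, Fin.succAbove]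
  field_simp
  ring

theorem chord_axis_block (h1 : Real.cos φ ≠ 0) (h2 : Real.cos (2 * φ) ≠ 0) (k j : Fin 4) :
    starSum (tetRate φ (axisExt (Pi.single j 1))) (chordEdge k) =
      chordAxis (Real.cos φ) (Real.cos (2 * φ)) k j := by
  have e1 : (-1 : Fin 3) = 2 := rfl
  have e5 : (2 : Fin 3) - 1 = 1 := rfl
  fin_cases k <;> fin_cases j <;>
    simp [chordEdge, starSum_tetRate_OPmid _ _ h1 h2, starSum_tetRate_OPhigh _ h1 h2, axisExt,
      chordAxis, height, Fin.sum_univ_three, e1, e5] <;> norm_num <;> ring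

theorem axis_chord_block (h1 : Real.cos φ ≠ 0) (h2 : Real.cos (2 * φ) ≠ 0) (k j : Fin 4) :
    starSum (tetRate φ (chordExt (Pi.single j 1))) (axisEdge k) =
      chordAxis (Real.cos φ) (Real.cos (2 * φ)) j k := by
  have e1 : (2 : Fin 3) + 1 = 0 := rfl
  have e5 : (2 : Fin 3) - 1 = 1 := rfl
  fin_cases k <;> fin_cases j <;>
    simp [axisEdge, starSum_tetRate_AB _ h1 h2, starSum_tetRate_toB _ h1 h2,
      chordAxis, height, e1, e5] <;> norm_num <;> ring

theorem minor3_matF3 (h0 : Real.cos φ ≠ 1) (h1 : Real.cos φ ≠ 0) (h2 : Real.cos (2 * φ) ≠ 0) :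
    choice.minor3 (family.matF3 (abelianRep φ) (placement φ)) =
      -((1 - Real.cos φ) ^ 4 * (1 - 2 * Real.cos φ) ^ 4 /
        (167961600 * Real.cos φ ^ 12 * (2 * Real.cos φ ^ 2 - 1) ^ 6)) := by
  have hd : 2 * Real.cos φ ^ 2 - 1 ≠ 0 := by rwa [← Real.cos_two_mul]
  have hc : ∀ i, chordEdge i ≠ .inr .OPlow := by decide
  have ha : ∀ i, axisEdge i ≠ .inr .OPlow := by decide
  have hs : ∀ i, spokeEdge i ≠ .inr .OPlow := by decide
  rw [minor3_eq, det_of_zero_blocks]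
  · have hK : (of fun i j : Fin 4 => (family.matF3 (abelianRep φ) (placement φ)).submatrix
        restEdge restEdge (.inl i) (.inr (.inl j))) =
        -chordAxis (Real.cos φ) (Real.cos (2 * φ)) := by
      ext i j
      change family.matF3 _ _ (chordEdge i) (axisEdge j) = _
      rw [matF3_eq h1 h2 _ _ (hc i), single_axisEdge, chord_axis_block h1 h2]
      rfl
    have hK' : (of fun i j : Fin 4 => (family.matF3 (abelianRep φ) (placement φ)).submatrix
        restEdge restEdge (.inr (.inl i)) (.inl j)) =
        -(chordAxis (Real.cos φ) (Real.cos (2 * φ)))ᵀ := by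
      ext i j
      change family.matF3 _ _ (axisEdge i) (chordEdge j) = _
      rw [matF3_eq h1 h2 _ _ (ha i), single_chordEdge, axis_chord_block h1 h2]
      rfl
    have hD : (of fun i j : Fin 14 => (family.matF3 (abelianRep φ) (placement φ)).submatrix
        restEdge restEdge (.inr (.inr i)) (.inr (.inr j))) =
        (mainForms (Real.cos φ) (Real.sin φ))ᵀ * mainWeight (Real.cos φ) (Real.sin φ) *
        mainForms (Real.cos φ) (Real.sin φ) + extraFormsᵀ *
        extraWeight (Real.cos φ) (Real.sin φ) * extraForms := by
      ext i j
      change family.matF3 _ _ (spokeEdge i) (spokeEdge j) = _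
      rw [matF3_eq h1 h2 _ _ (hs i), single_spokeEdge, starSum_tetRate_spokeExt h1 h2,
        mulVec_single_one]
      rfl
    rw [hK, hK', hD, det_neg, det_neg, det_transpose, det_chordAxis h1 h2,
      det_spoke h1 (sub_ne_zero.2 (Ne.symm h0)) hd (Real.sin_sq φ), Real.cos_two_mul]
    simp only [Fintype.card_fin]
    field_simp
    ring
  · intro i j
    change family.matF3 _ _ (chordEdge i) (chordEdge j) = _
    rw [matF3_eq h1 h2 _ _ (hc i), single_chordEdge,
      starSum_tetRate_chord_eq_zero h1 h2 _ _ _ i, neg_zero]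
    · rintro (_ | _) <;> rfl
    · intro; rfl
  · intro i j
    change family.matF3 _ _ (chordEdge i) (spokeEdge j) = _
    rw [matF3_eq h1 h2 _ _ (hc i), single_spokeEdge,
      starSum_tetRate_chord_eq_zero h1 h2 _ _ _ i, neg_zero]
    · rintro (_ | _) <;> rfl
    · intro; rfl
  · intro i j
    change family.matF3 _ _ (spokeEdge i) (chordEdge j) = _
    rw [matF3_eq h1 h2 _ _ (hs i), single_chordEdge,
      starSum_tetRate_spoke_chordExt h1 h2, neg_zero]

end
end Trefoil
end

/-! ### The matrices f₁ and f₂: minors and rank. -/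

noncomputable section
namespace Trefoil

open Matrix FundamentalFamily

/-- A coordinate of `(dx)` as a linear functional. -/
abbrev coordForm (k : Coord TrefVL TrefVO) : (Coord TrefVL TrefVO → ℝ) →ₗ[ℝ] ℝ :=
  LinearMap.proj k

/-- The differential of `L_e` for the edge from `O`, turned through the angle `ψ`, to `P`. -/
def chordDiff (ψ : ℝ) : (Coord TrefVL TrefVO → ℝ) →ₗ[ℝ] ℝ :=
  (1 - Real.sin ψ) • (coordForm (dO 0) + coordForm (dP 1)) -
    Real.cos ψ • (coordForm (dO 1) + coordForm (dP 0))

/-- The differential of `L_e` for an edge from a link vertex to `O`. -/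
def spokeDiffO (v : TrefVL) : (Coord TrefVL TrefVO → ℝ) →ₗ[ℝ] ℝ :=
  coordForm (dO 0) + height v • (coordForm (Sum.inl v) - coordForm (dO 2))

/-- The differential of `L_e` for an edge from a link vertex to `P`. -/
def spokeDiffP (v : TrefVL) : (Coord TrefVL TrefVO → ℝ) →ₗ[ℝ] ℝ :=
  coordForm (dP 1) + height v • (coordForm (Sum.inl v) - coordForm (dP 2))

/-- The differential of `L_e` for an edge with both ends on the axis. -/
def axisDiff (v w : TrefVL) : (Coord TrefVL TrefVO → ℝ) →ₗ[ℝ] ℝ :=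
  (height v - height w) • (coordForm (Sum.inl v) - coordForm (Sum.inl w))

/-- The differential of `L_e`. -/
def edgeDiff (φ : ℝ) : TrefEL ⊕ TrefEO → (Coord TrefVL TrefVO → ℝ) →ₗ[ℝ] ℝ
  | .inl (.toA i) => axisDiff (.B (i - 1)) (.A i)
  | .inl (.toB i) => axisDiff (.A (i - 1)) (.B i)
  | .inr (.AB i) => axisDiff (.A i) (.B i)
  | .inr (.AO i) | .inr (.AO' i) => spokeDiffO (.A i)
  | .inr (.BO i) => spokeDiffO (.B i)
  | .inr (.AP i) => spokeDiffP (.A i)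
  | .inr (.BP i) | .inr (.BP' i) => spokeDiffP (.B i)
  | .inr .OPlow => chordDiff 0
  | .inr (.OPmid _) => chordDiff φ
  | .inr .OPhigh => chordDiff (2 * φ)

theorem move_link (φ : ℝ) (ξ : Coord TrefVL TrefVO → ℝ) (v : TrefVL) :
    ((placement φ).move ξ).pos (Sum.inl v) = !₂[0, 0, height v + ξ (Sum.inl v)] := by
  ext k
  change ((placement φ).pos (Sum.inl v) + _ : Pt) k = _
  rw [placement_link]
  fin_cases k <;> simp [placement]

theorem move_O (φ : ℝ) (ξ : Coord TrefVL TrefVO → ℝ) :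
    ((placement φ).move ξ).pos (Sum.inr .O) = !₂[1 + ξ (dO 0), ξ (dO 1), ξ (dO 2)] := by
  ext k
  simp only [Placement.move, placement]
  fin_cases k <;> simp

theorem move_P (φ : ℝ) (ξ : Coord TrefVL TrefVO → ℝ) :
    ((placement φ).move ξ).pos (Sum.inr .P) = !₂[ξ (dP 0), 1 + ξ (dP 1), ξ (dP 2)] := by
  ext k
  simp only [Placement.move, placement]
  fin_cases k <;> simp

/-- Half the squared length of an edge after a displacement of the vertices. -/
def movedHalfSq (φ : ℝ) (ξ : Coord TrefVL TrefVO → ℝ) : TrefEL ⊕ TrefEO → ℝ :=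
  let z v := height v + ξ (Sum.inl v)
  let axis v w := (z v - z w) ^ 2 / 2
  let spokeO v := ((1 + ξ (dO 0)) ^ 2 + ξ (dO 1) ^ 2 + (z v - ξ (dO 2)) ^ 2) / 2
  let spokeP v := (ξ (dP 0) ^ 2 + (1 + ξ (dP 1)) ^ 2 + (z v - ξ (dP 2)) ^ 2) / 2
  let chord ψ := ((1 + ξ (dO 0)) ^ 2 + ξ (dO 1) ^ 2 + ξ (dP 0) ^ 2 + (1 + ξ (dP 1)) ^ 2 +
    (ξ (dO 2) - ξ (dP 2)) ^ 2) / 2 -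
    (Real.cos ψ * (1 + ξ (dO 0)) - Real.sin ψ * ξ (dO 1)) * ξ (dP 0) -
    (Real.sin ψ * (1 + ξ (dO 0)) + Real.cos ψ * ξ (dO 1)) * (1 + ξ (dP 1))
  fun
  | .inl (.toA i) => axis (.B (i - 1)) (.A i)
  | .inl (.toB i) => axis (.A (i - 1)) (.B i)
  | .inr (.AB i) => axis (.A i) (.B i)
  | .inr (.AO i) | .inr (.AO' i) => spokeO (.A i)
  | .inr (.BO i) => spokeO (.B i)
  | .inr (.AP i) => spokeP (.A i)
  | .inr (.BP i) | .inr (.BP' i) => spokeP (.B i)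
  | .inr .OPlow => chord 0
  | .inr (.OPmid _) => chord φ
  | .inr .OPhigh => chord (2 * φ)

theorem edgeL_move (φ : ℝ) (ξ : Coord TrefVL TrefVO → ℝ) (e : TrefEL ⊕ TrefEO) :
    family.edgeL (abelianRep φ) ((placement φ).move ξ) e = movedHalfSq φ ξ e := by
  have h1 := Real.sin_sq_add_cos_sq φ
  have h2 := Real.sin_sq_add_cos_sq (2 * φ)
  rw [edgeL, edgeLength, half_dist_sq]
  rcases e with (i | i) | (i | i | i | i | i | i | i | _ | i | _)
  all_goals
    simp only [FundamentalFamily.ends, edgeEnds, family, linkEnds, offEnds, vA, vB, vO, vP, image,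
      abelianRep_one, abelianRep_xgen, abelianRep_xgen_mul, move_link, move_O, move_P, rotZ_apply,
      movedHalfSq]
    simp
    try grind

/-- Half the squared length is a polynomial of degree two in the displacement, so its expansion
along a line is exact, and the coefficient of `s` is the differential. -/
theorem movedHalfSq_smul (φ s : ℝ) (ξ : Coord TrefVL TrefVO → ℝ) (e : TrefEL ⊕ TrefEO) :
    movedHalfSq φ (s • ξ) e = movedHalfSq φ 0 e + s * edgeDiff φ e ξ +
      s ^ 2 * (movedHalfSq φ ξ e - movedHalfSq φ 0 e - edgeDiff φ e ξ) := by
  rcases e with (i | i) | (i | i | i | i | i | i | i | _ | i | _) <;>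
    simp [movedHalfSq, edgeDiff, axisDiff, spokeDiffO, spokeDiffP, chordDiff] <;> ring

theorem matF2_eq (φ : ℝ) : family.matF2 (abelianRep φ) (placement φ) =
    of fun e k => edgeDiff φ e (Pi.single k 1) := by
  ext e k
  simp only [matF2, of_apply, edgeL_move]
  have hs : (fun s : ℝ => movedHalfSq φ (Pi.single k s) e) = fun s : ℝ =>
      movedHalfSq φ (s • Pi.single k 1) e := by
    funext s; rw [← Pi.single_smul]; simp
  simp only [movedHalfSq_smul] at hs
  have h : HasDerivAt (fun s : ℝ => movedHalfSq φ (Pi.single k s) e)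
      (edgeDiff φ e (Pi.single k 1)) 0 := by
    rw [hs]
    refine ((((hasDerivAt_id' (0 : ℝ)).mul_const _).const_add _).add
      (((hasDerivAt_id' (0 : ℝ)).fun_pow 2).mul_const _)).congr_deriv ?_
    simp
  rw [← h.deriv]
  refine congrArg (deriv · 0) (funext fun s => ?_)
  congr!

theorem matF2_mulVec (φ : ℝ) (ξ : Coord TrefVL TrefVO → ℝ) (e : TrefEL ⊕ TrefEO) :
    (family.matF2 (abelianRep φ) (placement φ) *ᵥ ξ) e = edgeDiff φ e ξ := by
  rw [LinearMap.pi_apply_eq_sum_univ, matF2_eq]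
  simp only [mulVec, dotProduct, of_apply, smul_eq_mul]
  refine Finset.sum_congr rfl fun k _ => ?_
  rw [mul_comm]
  congr 2
  funext j
  simp [Pi.single_apply, eq_comm]

theorem matF1_basisC0 (φ : ℝ) : matF1 (placement φ) basisC0 = of fun k => Sum.elim
    (fun _ => ![0, 1]) (fun w => match w with
      | (.O, k) => ![![0, 1, 0] k, ![0, 0, 1] k]
      | (.P, k) => ![![-1, 0, 0] k, ![0, 0, 1] k]) k := by
  ext (v | ⟨_ | _, k⟩) a
  · fin_cases a <;> cases v <;>
      simp [matF1, basisC0, placement, PiLp.inner_apply, Fin.sum_univ_three]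
  · fin_cases a <;> fin_cases k <;> simp [matF1, basisC0, placement]
  · fin_cases a <;> fin_cases k <;> simp [matF1, basisC0, placement]

theorem minor1_matF1 (φ : ℝ) : choice.minor1 (matF1 (placement φ) basisC0) = -1 := by
  rw [matF1_basisC0, MinorChoice.minor1, det_fin_two]
  simp [choice]

/-- Rotations about the axis and translations along it commute with the representation. They move
all lifts rigidly together and preserve every edge length to first order. -/
theorem matF2_mul_matF1 (φ : ℝ) :
    family.matF2 (abelianRep φ) (placement φ) * matF1 (placement φ) basisC0 = 0 := by
  ext e a
  change (family.matF2 (abelianRep φ) (placement φ) *ᵥ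
    fun k => matF1 (placement φ) basisC0 k a) e = 0
  rw [matF2_mulVec, matF1_basisC0]
  rcases e with (i | i) | (i | i | i | i | i | i | i | _ | i | _) <;> fin_cases a <;>
    simp [edgeDiff, axisDiff, spokeDiffO, spokeDiffP, chordDiff]

/-- The minor of `f₂`, with rows and columns reordered to make it lower triangular. -/
def minor2Table : Matrix (Fin 10) (Fin 10) ℤ :=
  !![-1, 0, 0, 0, 0, 0, 0, 0, 0, 0;
     0, -2, 0, 0, 0, 0, 0, 0, 0, 0;
     0, -4, 4, 0, 0, 0, 0, 0, 0, 0;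
     0, 0, 5, -5, 0, 0, 0, 0, 0, 0;
     0, 0, 0, -4, 4, 0, 0, 0, 0, 0;
     0, 0, 0, 0, 0, 1, 0, 0, 0, 0;
     0, 0, 0, 0, 0, 0, 1, 0, 0, 0;
     0, 0, 0, 0, 0, 1, 0, -3, 0, 0;
     0, 0, 0, 0, 0, 0, 1, 0, -3, 0;
     0, 0, 0, 0, 0, 1, 1, 0, 0, -1]

theorem det_minor2Table : minor2Table.det = 1440 := by
  rw [det_of_isLowerTriangular _ (by decide +kernel)]
  decide

/-- The order of the rows of `minor2Table`. -/
def rowPerm : Equiv.Perm (Fin 10) where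
  toFun := ![0, 1, 2, 3, 4, 7, 8, 5, 6, 9]
  invFun := ![0, 1, 2, 3, 4, 7, 8, 5, 6, 9]
  left_inv := by decide
  right_inv := by decide

/-- The order of the columns of `minor2Table`. -/
def colPerm : Equiv.Perm (Fin 10) where
  toFun := ![4, 3, 1, 2, 0, 5, 8, 6, 9, 7]
  invFun := ![4, 2, 3, 1, 0, 5, 7, 9, 6, 8]
  left_inv := by decide
  right_inv := by decide

theorem minor2_submatrix (φ : ℝ) :
    (((family.matF2 (abelianRep φ) (placement φ)).submatrix choice.b2 choice.c1).submatrix rowPerm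
      id).submatrix id colPerm = minor2Table.map (Int.castRingHom ℝ) := by
  have e1 : (0 : Fin 3) - 1 = 2 := rfl
  have e2 : (2 : Fin 3) - 1 = 1 := rfl
  rw [matF2_eq]
  ext i j
  simp only [submatrix_apply, of_apply, map_apply, id]
  fin_cases i <;> fin_cases j <;>
    simp [rowPerm, colPerm, choice, edgeDiff, axisDiff, spokeDiffO, spokeDiffP, chordDiff,
      minor2Table, height, e1, e2] <;> norm_num

/-- Both reorderings are even, so the minor equals the determinant of the triangular table. Of the
three kinds of chords, `𝓑₂` contains only `OPlow`, which is why the minor does not depend on the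
angle. -/
theorem minor2_matF2 (φ : ℝ) :
    choice.minor2 (family.matF2 (abelianRep φ) (placement φ)) = 1440 := by
  have h := congrArg det (minor2_submatrix φ)
  rw [det_permute', det_permute, ← RingHom.mapMatrix_apply, ← RingHom.map_det,
    det_minor2Table] at h
  rw [show Equiv.Perm.sign colPerm = 1 by decide +kernel,
    show Equiv.Perm.sign rowPerm = 1 by decide +kernel] at h
  simpa [MinorChoice.minor2] using h

/-- The image of f₁ has dimension at least two by its nonzero minor and lies in the kernel of f₂, so
the rank is at most `12 - 2`. The nonzero 10×10 minor gives the opposite bound. -/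
theorem rank_matF2 (φ : ℝ) : (family.matF2 (abelianRep φ) (placement φ)).rank = 10 := by
  apply le_antisymm
  · have h := rank_add_rank_le_card_of_mul_eq_zero (matF2_mul_matF1 φ)
    have h1 := rank_submatrix_le (matF1 (placement φ) basisC0) choice.b1 id
    rw [rank_of_isUnit _ ((Matrix.isUnit_iff_isUnit_det _).2
      (by rw [show det _ = _ from minor1_matF1 φ]; norm_num))] at h1
    have hc : Fintype.card (Coord TrefVL TrefVO) = 12 := by decide
    simp only [Fintype.card_fin] at h1
    omega
  · have h1 := rank_submatrix_le (family.matF2 (abelianRep φ) (placement φ)) choice.b2 choice.c1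
    rwa [rank_of_isUnit _ ((Matrix.isUnit_iff_isUnit_det _).2
      (by rw [show det _ = _ from minor2_matF2 φ]; norm_num)), Fintype.card_fin] at h1

end Trefoil
end

/-! ### The centralizer algebra. -/

noncomputable section
namespace Trefoil

open Matrix FundamentalFamily

theorem rotZ_inv (ψ : ℝ) : (rotZ ψ)⁻¹ = rotZ (-ψ) :=
  inv_eq_of_mul_eq_one_right (by rw [rotZ_mul, add_neg_cancel, rotZ_zero])

theorem exists_abelianRep_eq_rotZ (φ : ℝ) (h : TrefoilGroup) : ∃ ψ, abelianRep φ h = rotZ ψ := by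
  have hh : h ∈ Subgroup.closure (Set.range (PresentedGroup.of (rels := trefoilRels))) := by
    rw [PresentedGroup.closure_range_of]; trivial
  induction hh using Subgroup.closure_induction with
  | mem x hx =>
    obtain ⟨i, rfl⟩ := hx
    exact ⟨φ, abelianRep_xgen φ i⟩
  | one => exact ⟨0, abelianRep_one φ⟩
  | mul x y _ _ hx hy =>
    obtain ⟨a, ha⟩ := hx
    obtain ⟨b, hb⟩ := hy
    exact ⟨a + b, by rw [map_mul, ha, hb, rotZ_mul]⟩
  | inv x _ hx =>
    obtain ⟨a, ha⟩ := hx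
    exact ⟨-a, by rw [map_inv, ha, rotZ_inv]⟩

theorem adMotion_rotZ_eq_self_iff {ψ : ℝ} {u : Pt → Pt} :
    adMotion (rotZ ψ) u = u ↔ ∀ x, rotZ ψ (u x) = u (rotZ ψ x) := by
  constructor
  · intro h x
    have := congrFun h (rotZ ψ x)
    rw [← this]
    change _ = rotZ ψ (u ((rotZ ψ)⁻¹ (rotZ ψ x)))
    rw [show (rotZ ψ)⁻¹ (rotZ ψ x) = x from (rotZ ψ).symm_apply_apply x]
  · intro h
    funext x
    change rotZ ψ (u ((rotZ ψ)⁻¹ x)) = _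
    rw [h, show rotZ ψ ((rotZ ψ)⁻¹ x) = x from (rotZ ψ).apply_symm_apply x]

/-- The horizontal part of the rotation minus the identity has determinant `2 - 2 cos φ`, which is
nonzero. -/
theorem eq_zero_of_rotZ_eq_self {φ : ℝ} (h0 : Real.cos φ ≠ 1) {y : Pt} (hy : rotZ φ y = y) :
    y 0 = 0 ∧ y 1 = 0 := by
  rw [rotZ_apply] at hy
  have e0 : Real.cos φ * y 0 - Real.sin φ * y 1 = y 0 := congrArg (fun z : Pt => z 0) hy
  have e1 : Real.sin φ * y 0 + Real.cos φ * y 1 = y 1 := congrArg (fun z : Pt => z 1) hy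
  have hs := Real.sin_sq_add_cos_sq φ
  have h0' : 1 - Real.cos φ ≠ 0 := sub_ne_zero.2 h0.symm
  constructor
  · refine (mul_eq_zero.1 (?_ : (1 - Real.cos φ) * y 0 = 0)).resolve_left h0'
    linear_combination (Real.cos φ - 1) / 2 * e0 + Real.sin φ / 2 * e1 - y 0 / 2 * hs
  · refine (mul_eq_zero.1 (?_ : (1 - Real.cos φ) * y 1 = 0)).resolve_left h0'
    linear_combination (Real.cos φ - 1) / 2 * e1 - Real.sin φ / 2 * e0 - y 1 / 2 * hs

/-- The linear map `x ↦ e₃ × x`. -/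
def spin : Pt →ₗ[ℝ] Pt where
  toFun x := !₂[-x 1, x 0, 0]
  map_add' x y := by
    ext i; fin_cases i <;> simp [add_comm]
  map_smul' r x := by
    ext i; fin_cases i <;> simp

theorem basisC0_mem_centralizerAlgebra (φ : ℝ) (a : Fin 2) :
    basisC0 a ∈ centralizerAlgebra (abelianRep φ) := by
  constructor
  · fin_cases a
    · exact ⟨spin, 0, fun x => by
        simp [spin, PiLp.inner_apply, Fin.sum_univ_three]; ring, fun x => by simp [basisC0, spin]⟩
    · exact ⟨0, !₂[0, 0, 1], by simp, by simp [basisC0]⟩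
  · intro h
    obtain ⟨ψ, hψ⟩ := exists_abelianRep_eq_rotZ φ h
    rw [hψ, adMotion_rotZ_eq_self_iff]
    intro x
    ext i
    fin_cases a <;> fin_cases i <;> simp [basisC0, rotZ_apply] <;> ring

theorem linearIndependent_basisC0 : LinearIndependent ℝ basisC0 := by
  refine LinearIndependent.pair_iff.2 fun s t h => ?_
  have h' := congrFun h !₂[1, 0, 0]
  have h1 := congrArg (fun z : Pt => z 1) h'
  have h2 := congrArg (fun z : Pt => z 2) h'
  simp at h1 h2
  exact ⟨h1, h2⟩

theorem inner_map_swap_of_skew {E : Type*} [NormedAddCommGroup E] [InnerProductSpace ℝ E]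
    {S : E →ₗ[ℝ] E} (hS : ∀ x, inner ℝ (S x) x = 0) (x y : E) :
    inner ℝ (S x) y = -inner ℝ (S y) x := by
  have h := hS (x + y)
  simp only [map_add, inner_add_left, inner_add_right] at h
  linarith [hS x, hS y]

/-- A field commuting with a nontrivial rotation is vertical at each point of the axis. At the
origin this makes `t` vertical; at height one it makes `S e₃` vertical, hence zero by skewness. One
entry of `S` and one of `t` remain free. -/
theorem span_basisC0 {φ : ℝ} (h0 : Real.cos φ ≠ 1) :
    Submodule.span ℝ (Set.range basisC0) = centralizerAlgebra (abelianRep φ) := by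
  apply le_antisymm
  · rw [Submodule.span_le]
    rintro _ ⟨a, rfl⟩
    exact basisC0_mem_centralizerAlgebra φ a
  rintro u ⟨⟨S, t, hS, hu⟩, hρ⟩
  have hc : ∀ x, rotZ φ (u x) = u (rotZ φ x) := by
    have := hρ (xgen 0)
    rwa [abelianRep_xgen, adMotion_rotZ_eq_self_iff] at this
  have hu0 := eq_zero_of_rotZ_eq_self h0 (y := u 0) (by
    rw [hc]; congr 1; rw [rotZ_apply]; ext i; fin_cases i <;> simp)
  have hu1 := eq_zero_of_rotZ_eq_self h0 (y := u !₂[0, 0, 1]) (by rw [hc, rotZ_axis])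
  have hskew := inner_map_swap_of_skew hS
  have hb : ∀ (x : Pt) (i : Fin 3), inner ℝ x (EuclideanSpace.single i (1 : ℝ)) = x i := by
    intro x i; simp [EuclideanSpace.inner_single_right]
  set e : Fin 3 → Pt := fun i => EuclideanSpace.single i (1 : ℝ) with he
  have hdec : ∀ x : Pt, S x = x 0 • S (e 0) + x 1 • S (e 1) + x 2 • S (e 2) := by
    intro x
    rw [← map_smul, ← map_smul, ← map_smul, ← map_add, ← map_add]
    congr 1
    ext i
    fin_cases i <;> simp [he]
  have hsk : ∀ i j, S (e i) j = -S (e j) i := by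
    intro i j
    rw [← hb, ← hb, hskew]
  have he2 : (!₂[0, 0, 1] : Pt) = e 2 := by
    ext i; fin_cases i <;> simp [he]
  have ht : t 0 = 0 ∧ t 1 = 0 := by simpa [hu] using hu0
  rw [he2, hu] at hu1
  have h20 : S (e 2) 0 = 0 := by simpa [ht.1] using hu1.1
  have h21 : S (e 2) 1 = 0 := by simpa [ht.2] using hu1.2
  have hd : ∀ i, S (e i) i = 0 := fun i => by linarith [hsk i i]
  have h02 := hsk 0 2
  have h12 := hsk 1 2
  have h01 := hsk 1 0
  rw [basisC0, range_cons, range_cons, range_empty, Set.union_empty, Set.singleton_union,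
    Submodule.mem_span_pair]
  -- The angular velocity about the axis and the speed along it.
  refine ⟨S (e 0) 1, t 2, ?_⟩
  funext x
  rw [hu, hdec x]
  ext i
  fin_cases i <;> simp [hd, h20, h21, h02, h12, h01, ht.1, ht.2, mul_comm]

end Trefoil
end

/-! ### The normalizing products and the value of the invariant. -/

noncomputable section
namespace Trefoil

open Matrix FundamentalFamily

theorem prod_edgeLength_sq (φ : ℝ) :
    ∏ e : TrefEL, family.edgeLength (abelianRep φ) (placement φ) (Sum.inl e) ^ 2 = 102400 := by
  have h : ∀ e, family.edgeLength (abelianRep φ) (placement φ) e ^ 2 = 2 * edgeHalfSq φ e := by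
    intro e
    rw [← edgeL_eq, edgeL]
    ring
  have hu : (Finset.univ : Finset TrefEL) = {.toA 0, .toA 1, .toA 2, .toB 0, .toB 1, .toB 2} := by
    decide
  have e1 : (0 : Fin 3) - 1 = 2 := rfl
  have e2 : (2 : Fin 3) - 1 = 1 := rfl
  simp only [h, hu]
  simp [edgeHalfSq, height, e1, e2]
  norm_num

/-- The cosine in the volume is 1 for the six tetrahedra of the outer region `low`, `cos φ` for the
twelve of the bigons and `cos 2φ` for the six of `high`. Half of the height differences are
negative, an even number, so the constant is positive. These cosine powers are exactly those in the
denominator of the minor of f₃. -/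
theorem prod_signedVol (φ : ℝ) :
    ∏ t : TrefT, (-6 * family.signedVol (abelianRep φ) (placement φ) t) =
      54419558400 * Real.cos φ ^ 12 * Real.cos (2 * φ) ^ 6 := by
  have e1 : (0 : Fin 3) - 1 = 2 := rfl
  have e2 : (2 : Fin 3) - 1 = 1 := rfl
  simp only [signedVol_eq]
  -- Passing to the additive copy of `ℝ` turns the enumeration of a sum into that of a product.
  have h := sum_tet (M := Additive ℝ) fun t => Additive.ofMul
    (-6 * ((height (axisEnds t).2 - height (axisEnds t).1) * Real.cos (turn φ t) / 6))
  have h' := congrArg Additive.toMul h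
  simp only [toMul_sum, toMul_ofMul, toMul_add] at h'
  rw [h', Fin.prod_univ_three]
  simp [axisEnds, turn, height, e1, e2]
  ring

theorem invariant_eq {φ : ℝ} (h0 : Real.cos φ ≠ 1) (h1 : Real.cos φ ≠ 0) (h2 : Real.cos (2 * φ) ≠ 0) :
    family.invariant (abelianRep φ) (placement φ) basisC0 choice =
      -((2 - 2 * Real.cos φ) ^ 2 / (1 - 2 * Real.cos φ) ^ 4) := by
  have hd : 2 * Real.cos φ ^ 2 - 1 ≠ 0 := by rwa [← Real.cos_two_mul]
  have hc : 1 - Real.cos φ ≠ 0 := sub_ne_zero.2 (Ne.symm h0)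
  have hcard : ∀ (j : Unit) [Fintype {v : TrefVL // family.compV v = j}],
      Fintype.card {v : TrefVL // family.compV v = j} = 6 := fun j _ => by
    rw [Fintype.card_congr (Equiv.subtypeUnivEquiv fun v => rfl)]
    rfl
  have hm1 : ∀ d : DecidableEq (Fin 2), @MinorChoice.minor1 _ _ _ _ _ d choice
      (matF1 (placement φ) basisC0) = -1 := fun d => by convert minor1_matF1 φ
  have hm2 : ∀ d : DecidableEq (Fin 10), @MinorChoice.minor2 _ _ _ _ _ d choice
      (family.matF2 (abelianRep φ) (placement φ)) = 1440 := fun d => by convert minor2_matF2 φ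
  rw [invariant]
  unfold MinorChoice.torsion
  rw [hm1, hm2, minor3_matF3 h0 h1 h2, rank_matF2,
    prod_edgeLength_sq, prod_signedVol, Real.cos_two_mul]
  rw [Fintype.prod_unique, hcard]
  simp only [placement]
  rw [show 2 - 2 * Real.cos φ = 2 * (1 - Real.cos φ) by ring]
  generalize 2 * Real.cos φ ^ 2 - 1 = d at *
  field_simp
  norm_num

/-- With `z = e^{iφ}`, `|z - 1|² = 2 - 2 cos φ` and `z² - z + 1 = z (z + z⁻¹ - 1) = (2 cos φ - 1)
z`. -/
theorem norm_exp_ratio_pow_four (φ : ℝ) :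
    ‖(Complex.exp (φ * Complex.I) - 1) /
      (Complex.exp (φ * Complex.I) ^ 2 - Complex.exp (φ * Complex.I) + 1)‖ ^ 4 =
      (2 - 2 * Real.cos φ) ^ 2 / (1 - 2 * Real.cos φ) ^ 4 := by
  have hs := Real.sin_sq_add_cos_sq φ
  have hz : Complex.exp (φ * Complex.I) = ⟨Real.cos φ, Real.sin φ⟩ := by
    apply Complex.ext <;> simp [Complex.exp_ofReal_mul_I_re, Complex.exp_ofReal_mul_I_im]
  have hn : ‖Complex.exp (φ * Complex.I) - 1‖ ^ 2 = 2 - 2 * Real.cos φ := by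
    rw [hz, Complex.sq_norm, Complex.normSq_apply]
    simp
    linear_combination hs
  have hD : Complex.exp (φ * Complex.I) ^ 2 - Complex.exp (φ * Complex.I) + 1 =
      ((2 * Real.cos φ - 1 : ℝ) : ℂ) * Complex.exp (φ * Complex.I) := by
    rw [hz]
    generalize Real.cos φ = c at *
    apply Complex.ext <;> simp [sq]
    · linear_combination -hs
    · ring
  rw [norm_div, div_pow, hD, norm_mul, Complex.norm_exp_ofReal_mul_I, mul_one, Complex.norm_real,
    Real.norm_eq_abs, (by norm_num : 4 = 2 * 2), pow_mul, hn, pow_mul, sq_abs, ← pow_mul]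
  congr 1
  ring

end Trefoil
end

theorem mainTheorem1 (φ : ℝ) (hρ : Real.cos φ ≠ 1) (hV₁ : Real.cos φ ≠ 0)
    (hV₂ : Real.cos (2 * φ) ≠ 0) :
    (LinearIndependent ℝ Trefoil.basisC0 ∧
      Submodule.span ℝ (Set.range Trefoil.basisC0) = centralizerAlgebra (abelianRep φ)) ∧
    Trefoil.choice.minor1 (matF1 (Trefoil.placement φ) Trefoil.basisC0) = -1 ∧
    Trefoil.choice.minor2 (Trefoil.family.matF2 (abelianRep φ) (Trefoil.placement φ)) = 1440 ∧
    Trefoil.choice.minor3 (Trefoil.family.matF3 (abelianRep φ) (Trefoil.placement φ)) =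
      -((1 - Real.cos φ) ^ 4 * (1 - 2 * Real.cos φ) ^ 4 /
        (167961600 * Real.cos φ ^ 12 * (2 * Real.cos φ ^ 2 - 1) ^ 6)) ∧
    (1 - 2 * Real.cos φ ≠ 0 →
      Trefoil.family.invariant (abelianRep φ) (Trefoil.placement φ) Trefoil.basisC0
          Trefoil.choice =
        -((2 - 2 * Real.cos φ) ^ 2 / (1 - 2 * Real.cos φ) ^ 4) ∧
      Trefoil.family.invariant (abelianRep φ) (Trefoil.placement φ) Trefoil.basisC0
          Trefoil.choice =
        -(‖(Complex.exp (φ * Complex.I) - 1) /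
            (Complex.exp (φ * Complex.I) ^ 2 - Complex.exp (φ * Complex.I) + 1)‖ ^ 4)) := by
  refine ⟨⟨Trefoil.linearIndependent_basisC0, Trefoil.span_basisC0 hρ⟩, Trefoil.minor1_matF1 φ,
    Trefoil.minor2_matF2 φ, Trefoil.minor3_matF3 hρ hV₁ hV₂, fun _ => ?_⟩
  rw [Trefoil.norm_exp_ratio_pow_four]
  exact ⟨Trefoil.invariant_eq hρ hV₁ hV₂, Trefoil.invariant_eq hρ hV₁ hV₂⟩
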